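/- Let $k$ be a field. **Framed correspondences.** Let $X,Y$ be $k$-schemes and $n\ge 0$. An explicit framed correspondence of level $n$ from $X$ to $Y$ is a tuple $(Z,W,\varphi;g)$ consisting of a closed subset $Z\subset\mathbb A^n_X$ which, with its reduced structure, is finite over $X$ (the support), an étale neighbourhood $W$ of $Z$ (an étale morphism $p:W\to\mathbb A^n_X$ together with a section $s:Z\to W$ over $Z$), regular functions $\varphi=(\varphi_1,\dots,\varphi_n)$ on $W$ whose common vanishing locus is $s(Z)$, and a $k$-morphism $g:W\to Y$. Two of them, $(Z,W,\varphi;g)$ and $(Z,W',\varphi';g')$, with the same support are equivalent if $\varphi=\varphi'$ and $g=g'$ on some open neighbourhood of $Z$ in $W\times_{\mathbb A^n_X}W'$. The set of equivalence classes is $Fr_n(X,Y)$. The group $\mathbb ZF_n(X,Y)$ is the quotient of the free abelian group on $Fr_n(X,Y)$ by the subgroup generated by the elements $$(Z_1\sqcup Z_2,W,\varphi;g)-(Z_1,W\setminus s(Z_2),\varphi;g)-(Z_2,W\setminus s(Z_1),\varphi;g).$$ A morphism $X'\to X$ induces a pullback $\mathbb ZF_n(X,Y)\to\mathbb ZF_n(X',Y)$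 by base change, and for a morphism $f:Y\to Y'$ the composite $f\circ(Z,W,\varphi;g)=(Z,W,\varphi;f\circ g)$ induces $\mathbb ZF_n(X,Y)\to\mathbb ZF_n(X,Y')$, $a\mapsto f\circ a$. Put $$\overline{\mathbb ZF}_n(X,Y)=\operatorname{coker}\bigl[\,i_0^*-i_1^*:\mathbb ZF_n(\mathbb A^1\times X,Y)\to\mathbb ZF_n(X,Y)\bigr],$$ where $i_0,i_1:X\to\mathbb A^1\times X$ are the sections at $0$ and $1$; write $[a]$ for the class of $a$, and $[f]\circ[a]=[f\circ a]$. Finally let $\sigma_X\in\mathbb ZF_1(X,X)$ be the class of $(X\times 0,\ X\times\mathbb A^1,\ t;\ pr_X)$, with $t$ the coordinate on $\mathbb A^1$. **Theorem (injectivity on the affine line).** Let $U\subset\mathbb A^1_k$ be an open subset and let $i:V\hookrightarrow U$ be the inclusion of a non-empty open subset. Then there is a morphism $r\in\mathbb ZF_1(U,V)$ such that $$[i]\circ[r]=[\sigma_U]\quad\text{in}\quad\overline{\mathbb ZF}_1(U,U).$$ -/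

import Mathlib

open CategoryTheory CategoryTheory.Limits AlgebraicGeometry TopologicalSpace

noncomputable section

namespace FramedTransfers

universe u

/-! ### Reduced closed subschemes and affine spaces -/

/-- The closed subset `Z` of `A`, with its reduced scheme structure. -/
abbrev Red {A : Scheme.{u}} (Z : Closeds A) : Scheme.{u} :=
  (Scheme.IdealSheafData.vanishingIdeal Z).subscheme

/-- The closed immersion of `Red Z` into the ambient scheme. -/
abbrev redι {A : Scheme.{u}} (Z : Closeds A) : Red Z ⟶ A :=
  (Scheme.IdealSheafData.vanishingIdeal Z).subschemeι

theorem range_redι {A : Scheme.{u}} (Z : Closeds A) : Set.range (redι Z) = Z := by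
  rw [Scheme.IdealSheafData.range_subschemeι, Scheme.IdealSheafData.coe_support_vanishingIdeal]

/-- If `f` maps the closed subset `Z'` into `Z`, it induces a morphism of reduced subschemes. -/
def redMap {A' A : Scheme.{u}} (f : A' ⟶ A) {Z' : Closeds A'} {Z : Closeds A}
    (h : Z' ≤ Z.preimage f.continuous) : Red Z' ⟶ Red Z :=
  Scheme.IdealSheafData.subschemeMap _ _ f (by
    rw [Scheme.IdealSheafData.le_map_iff_comap_le,
      ← Scheme.IdealSheafData.le_support_iff_le_vanishingIdeal,
      Scheme.IdealSheafData.support_comap]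
    have : (Scheme.IdealSheafData.vanishingIdeal Z).support = Z :=
      Closeds.ext (Scheme.IdealSheafData.coe_support_vanishingIdeal Z)
    rwa [this])

@[simp]
theorem redMap_ι {A' A : Scheme.{u}} (f : A' ⟶ A) {Z' : Closeds A'} {Z : Closeds A}
    (h : Z' ≤ Z.preimage f.continuous) : redMap f h ≫ redι Z = redι Z' ≫ f :=
  Scheme.IdealSheafData.subschemeMap_subschemeι _ _ _ _

/-- The inclusion of reduced subschemes attached to an inclusion of closed subsets. -/
def redIncl {A : Scheme.{u}} {Z' Z : Closeds A} (h : Z' ≤ Z) : Red Z' ⟶ Red Z :=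
  Scheme.IdealSheafData.inclusion (Scheme.IdealSheafData.vanishingIdeal_antimono h)

@[simp]
theorem redIncl_ι {A : Scheme.{u}} {Z' Z : Closeds A} (h : Z' ≤ Z) :
    redIncl h ≫ redι Z = redι Z' :=
  Scheme.IdealSheafData.inclusion_subschemeι _

/-- Affine `n`-space over a scheme. -/
abbrev Aff (n : ℕ) (X : Scheme.{u}) : Scheme.{u} := AffineSpace (ULift.{u} (Fin n)) X

/-- The projection `A^n_X ⟶ X`. -/
abbrev affProj (n : ℕ) (X : Scheme.{u}) : Aff n X ⟶ X := Aff n X ↘ X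

/-- The morphism `A^n_{X'} ⟶ A^n_X` induced by `f : X' ⟶ X`. -/
abbrev affMap (n : ℕ) {X' X : Scheme.{u}} (f : X' ⟶ X) : Aff n X' ⟶ Aff n X :=
  AffineSpace.map (ULift.{u} (Fin n)) f

variable {S : Scheme.{u}}

/-! ### Explicit framed correspondences -/

/-- An explicit framed correspondence of level `n` from `X` to `Y` (schemes over the base `S`):
a closed subset `Z` of `A^n_X` that is finite over `X`, an étale neighbourhood
`(p : W ⟶ A^n_X, s : Z ⟶ W)` of `Z`, regular functions `φ₁, …, φₙ` on `W` whose common vanishing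
locus is (the copy `s(Z)` of) `Z`, and an `S`-morphism `g : W ⟶ Y`. -/
structure Explicit (n : ℕ) (X Y : Over S) where
  /-- the support -/
  Z : Closeds (Aff n X.left)
  finite_Z : IsFinite (redι Z ≫ affProj n X.left)
  /-- the étale neighbourhood of the support -/
  W : Scheme.{u}
  /-- the étale morphism to affine space -/
  p : W ⟶ Aff n X.left
  etale_p : Etale p
  /-- the section over the support -/
  s : Red Z ⟶ W
  s_p : s ≫ p = redι Z
  /-- the framing -/
  φ : Fin n → Γ(W, ⊤)
  zeroLocus_φ : W.zeroLocus (Set.range φ) = Set.range s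
  /-- the morphism to the target -/
  g : W ⟶ Y.left
  g_over : g ≫ Y.hom = p ≫ affProj n X.left ≫ X.hom

attribute [instance] Explicit.finite_Z Explicit.etale_p
attribute [simp] Explicit.s_p

namespace Explicit

variable {n : ℕ} {X X' Y Y' : Over S}

/-- Two explicit framed correspondences are equivalent if they have the same support `Z` and if
there is an open neighbourhood `V` of `Z` in `W ×_{A^n_X} W'` on which the framings and the
morphisms to `Y` agree. -/
def Rel (a b : Explicit n X Y) : Prop :=
  ∃ (h : a.Z = b.Z) (V : (pullback a.p b.p).Opens),
    Set.range (pullback.lift (f := a.p) (g := b.p) a.s (redIncl h.le ≫ b.s) (by simp)) ⊆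
      (V : Set (pullback a.p b.p : Scheme.{u})) ∧
    (∀ i, (V.ι ≫ pullback.fst a.p b.p).appTop (a.φ i) =
      (V.ι ≫ pullback.snd a.p b.p).appTop (b.φ i)) ∧
    V.ι ≫ pullback.fst a.p b.p ≫ a.g = V.ι ≫ pullback.snd a.p b.p ≫ b.g

/-- A morphism of étale neighbourhoods that respects all the data gives an equivalence. -/
theorem Rel.of_hom {a b : Explicit n X Y} (h : a.Z = b.Z) (e : a.W ⟶ b.W)
    (hp : e ≫ b.p = a.p) (hs : a.s ≫ e = redIncl h.le ≫ b.s)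
    (hφ : ∀ i, e.appTop (b.φ i) = a.φ i) (hg : e ≫ b.g = a.g) : Rel a b := by
  let γ : a.W ⟶ pullback a.p b.p := pullback.lift (𝟙 _) e (by simp [hp])
  have h1 : γ ≫ pullback.fst a.p b.p = 𝟙 _ := pullback.lift_fst _ _ _
  have h2 : γ ≫ pullback.snd a.p b.p = e := pullback.lift_snd _ _ _
  have : Etale (γ ≫ pullback.fst a.p b.p) := by rw [h1]; infer_instance
  have : Etale γ := Etale.of_comp γ (pullback.fst a.p b.p)
  have : Mono γ := mono_of_mono_fac h1
  have : Smooth γ := inferInstance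
  have : IsOpenImmersion γ := IsOpenImmersion.of_flat_of_mono γ
  have key : ∃ q : (γ.opensRange : Scheme) ⟶ a.W, q ≫ γ = γ.opensRange.ι :=
    ⟨IsOpenImmersion.lift γ γ.opensRange.ι (by simp), IsOpenImmersion.lift_fac _ _ _⟩
  obtain ⟨q, hq⟩ := key
  refine ⟨h, γ.opensRange, ?_, fun i ↦ ?_, ?_⟩
  · have : pullback.lift (f := a.p) (g := b.p) a.s (redIncl h.le ≫ b.s) (by simp) = a.s ≫ γ := by
      apply pullback.hom_ext <;> simp [h1, h2, hs, pullback.lift_fst, pullback.lift_snd]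
    rw [this, Scheme.Hom.comp_base, TopCat.coe_comp]
    exact Set.range_comp_subset_range _ _
  · rw [← hq, Category.assoc, Category.assoc, h1, h2, Category.comp_id, ← hφ,
      Scheme.Hom.comp_appTop, CommRingCat.comp_apply]
  · rw [← hq, Category.assoc, Category.assoc, reassoc_of% h1, reassoc_of% h2, hg]

theorem isClosedImmersion_redMap {A' A : Scheme.{u}} (f : A' ⟶ A) {Z' : Closeds A'}
    {Z : Closeds A} (h : Z' ≤ Z.preimage f.continuous) :
    IsClosedImmersion (pullback.lift (redι Z') (redMap f h) (by simp) :
      Red Z' ⟶ pullback f (redι Z)) := by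
  have : IsClosedImmersion ((pullback.lift (redι Z') (redMap f h) (by simp) :
      Red Z' ⟶ pullback f (redι Z)) ≫ pullback.fst f (redι Z)) := by
    rw [pullback.lift_fst]; infer_instance
  exact .of_comp _ (pullback.fst f (redι Z))

theorem surjective_redMap {A' A : Scheme.{u}} (f : A' ⟶ A) (Z : Closeds A) :
    Function.Surjective (pullback.lift (redι (Z.preimage f.continuous)) (redMap f le_rfl)
      (by simp) : Red (Z.preimage f.continuous) ⟶ pullback f (redι Z)) := by
  intro x
  have hx : pullback.fst f (redι Z) x ∈ Set.range (redι (Z.preimage f.continuous)) := by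
    have : pullback.fst f (redι Z) x ∈ Set.range (pullback.fst f (redι Z)) := ⟨x, rfl⟩
    rw [Scheme.Pullback.range_fst, range_redι] at this
    rwa [range_redι]
  obtain ⟨y, hy⟩ := hx
  refine ⟨y, (pullback.fst f (redι Z)).injective ?_⟩
  rw [← Scheme.Hom.comp_apply, pullback.lift_fst, hy]

/-- The base change of the section `s` along `A^n_{X'} ⟶ A^n_X`. -/
def precompSection (f : X' ⟶ X) (a : Explicit n X Y) :
    Red (a.Z.preimage (affMap n f.left).continuous) ⟶ pullback a.p (affMap n f.left) :=
  pullback.lift (redMap (affMap n f.left) le_rfl ≫ a.s) (redι _) (by simp)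

theorem precompSection_fst (f : X' ⟶ X) (a : Explicit n X Y) :
    precompSection f a ≫ pullback.fst _ _ = redMap (affMap n f.left) le_rfl ≫ a.s :=
  pullback.lift_fst _ _ _

theorem precompSection_snd (f : X' ⟶ X) (a : Explicit n X Y) :
    precompSection f a ≫ pullback.snd _ _ = redι _ :=
  pullback.lift_snd _ _ _

theorem preimage_range_s (f : X' ⟶ X) (a : Explicit n X Y) :
    pullback.fst a.p (affMap n f.left) ⁻¹' Set.range a.s =
      Set.range (precompSection f a) := by
  let F := affMap n f.left
  let τ : pullback F (redι a.Z) ⟶ pullback a.p F :=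
    pullback.lift (pullback.snd _ _ ≫ a.s) (pullback.fst _ _) (by simp [pullback.condition])
  let m : pullback a.s (pullback.fst a.p F) ⟶ pullback F (redι a.Z) :=
    pullback.lift (pullback.snd _ _ ≫ pullback.snd _ _) (pullback.fst _ _) (by
      rw [Category.assoc, ← pullback.condition, ← pullback.condition_assoc, a.s_p])
  have hm : m ≫ τ = pullback.snd _ _ := by
    apply pullback.hom_ext
    · simp [m, τ, pullback.lift_fst, pullback.lift_snd_assoc, pullback.condition]
    · simp [m, τ, pullback.lift_fst, pullback.lift_snd]
  have hσ : pullback.lift (redι (a.Z.preimage F.continuous)) (redMap F le_rfl) (by simp) ≫ τ =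
      precompSection f a := by
    apply pullback.hom_ext <;>
      simp [τ, precompSection, F, pullback.lift_fst, pullback.lift_snd, pullback.lift_snd_assoc]
  ext x
  constructor
  · intro hx
    change x ∈ pullback.fst a.p F ⁻¹' Set.range a.s at hx
    rw [← Scheme.Pullback.range_snd] at hx
    obtain ⟨w, rfl⟩ := hx
    obtain ⟨y, hy⟩ := surjective_redMap F a.Z (m w)
    refine ⟨y, ?_⟩
    rw [← hσ, Scheme.Hom.comp_apply, hy, ← Scheme.Hom.comp_apply, hm]
  · rintro ⟨y, rfl⟩
    refine ⟨redMap F (Z := a.Z) le_rfl y, ?_⟩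
    rw [← Scheme.Hom.comp_apply, ← Scheme.Hom.comp_apply, precompSection_fst]

/-- The pullback (precomposition) of an explicit framed correspondence along `f : X' ⟶ X`:
all data are base changed along `A^n_{X'} ⟶ A^n_X`. -/
@[simps]
def precomp (f : X' ⟶ X) (a : Explicit n X Y) : Explicit n X' Y where
  Z := a.Z.preimage (affMap n f.left).continuous
  finite_Z := by
    have := isClosedImmersion_redMap (affMap n f.left)
      (Z := a.Z) (Z' := a.Z.preimage (affMap n f.left).continuous) le_rfl
    have hP := (IsPullback.of_hasPullback (affMap n f.left) (redι a.Z)).flip.paste_vert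
      (AffineSpace.isPullback_map (n := ULift.{u} (Fin n)) f.left)
    have h2 : IsFinite (pullback.fst (affMap n f.left) (redι a.Z) ≫ affProj n X'.left) :=
      MorphismProperty.of_isPullback hP a.finite_Z
    rw [← pullback.lift_fst (f := affMap n f.left) (g := redι a.Z) (redι _)
      (redMap (affMap n f.left) le_rfl) (by simp), Category.assoc]
    infer_instance
  W := pullback a.p (affMap n f.left)
  p := pullback.snd _ _
  etale_p := inferInstance
  s := precompSection f a
  s_p := pullback.lift_snd _ _ _
  φ i := (pullback.fst a.p (affMap n f.left)).appTop (a.φ i)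
  zeroLocus_φ := by
    have h := Scheme.preimage_zeroLocus (pullback.fst a.p (affMap n f.left)) (Set.range a.φ)
    rw [a.zeroLocus_φ, preimage_range_s, ← Set.range_comp] at h
    exact h.symm
  g := pullback.fst _ _ ≫ a.g
  g_over := by
    rw [Category.assoc, a.g_over, pullback.condition_assoc, AffineSpace.map_over_assoc, Over.w]

theorem Rel.precomp (f : X' ⟶ X) {a b : Explicit n X Y} (r : Rel a b) :
    Rel (a.precomp f) (b.precomp f) := by
  obtain ⟨h, V, hV, hφ, hg⟩ := r
  let F := affMap n f.left
  let P := pullback (pullback.snd a.p F) (pullback.snd b.p F)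
  let M : P ⟶ pullback a.p b.p :=
    pullback.lift (pullback.fst _ _ ≫ pullback.fst _ _) (pullback.snd _ _ ≫ pullback.fst _ _) (by
      rw [Category.assoc, Category.assoc, pullback.condition, pullback.condition,
        pullback.condition_assoc])
  have M1 : M ≫ pullback.fst a.p b.p = pullback.fst _ _ ≫ pullback.fst a.p F :=
    pullback.lift_fst _ _ _
  have M2 : M ≫ pullback.snd a.p b.p = pullback.snd _ _ ≫ pullback.fst b.p F :=
    pullback.lift_snd _ _ _
  have hh : a.Z.preimage F.continuous = b.Z.preimage F.continuous := by rw [h]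
  have hN : (M ∣_ V) ≫ V.ι = (M ⁻¹ᵁ V).ι ≫ M := morphismRestrict_ι M V
  refine ⟨hh, M ⁻¹ᵁ V, ?_, fun i ↦ ?_, ?_⟩
  · let sP : Red (a.Z.preimage F.continuous) ⟶ P :=
      pullback.lift (precompSection f a) (redIncl hh.le ≫ precompSection f b)
        (by rw [precompSection_snd, Category.assoc, precompSection_snd, redIncl_ι])
    have hi : redIncl hh.le ≫ redMap F (Z := b.Z) le_rfl =
        redMap F (Z := a.Z) le_rfl ≫ redIncl h.le := by
      rw [← cancel_mono (redι b.Z), Category.assoc, redMap_ι, Category.assoc, redIncl_ι, redMap_ι,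
        ← Category.assoc, redIncl_ι]
    have hs : sP ≫ M = redMap F (Z := a.Z) le_rfl ≫
        pullback.lift (f := a.p) (g := b.p) a.s (redIncl h.le ≫ b.s) (by simp) := by
      apply pullback.hom_ext
      · rw [Category.assoc, M1, pullback.lift_fst_assoc, precompSection_fst, Category.assoc,
          pullback.lift_fst]
      · rw [Category.assoc, M2, pullback.lift_snd_assoc, Category.assoc, precompSection_fst,
          Category.assoc, pullback.lift_snd, reassoc_of% hi]
    refine (?_ : Set.range sP ⊆ (M ⁻¹ᵁ V : P.Opens))
    rintro _ ⟨y, rfl⟩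
    change M (sP y) ∈ V
    rw [← Scheme.Hom.comp_apply, hs, Scheme.Hom.comp_apply]
    exact hV ⟨_, rfl⟩
  · have := congr((M ∣_ V).appTop $(hφ i))
    rw [← CommRingCat.comp_apply, ← CommRingCat.comp_apply, ← Scheme.Hom.comp_appTop,
      ← Scheme.Hom.comp_appTop, reassoc_of% hN, reassoc_of% hN, M1, M2] at this
    change ((M ⁻¹ᵁ V).ι ≫ pullback.fst (pullback.snd a.p F) (pullback.snd b.p F)).appTop
      ((pullback.fst a.p F).appTop (a.φ i)) =
      ((M ⁻¹ᵁ V).ι ≫ pullback.snd (pullback.snd a.p F) (pullback.snd b.p F)).appTop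
      ((pullback.fst b.p F).appTop (b.φ i))
    rw [← CommRingCat.comp_apply, ← CommRingCat.comp_apply, ← Scheme.Hom.comp_appTop,
      ← Scheme.Hom.comp_appTop, Category.assoc, Category.assoc]
    exact this
  · have := congr((M ∣_ V) ≫ $hg)
    rw [reassoc_of% hN, reassoc_of% hN, reassoc_of% M1, reassoc_of% M2] at this
    exact this

/-- The composite of an explicit framed correspondence from `X` to `Y` with a morphism
`f : Y ⟶ Y'`, viewed as a framed correspondence of level `0`. -/
@[simps]
def postcomp (f : Y ⟶ Y') (a : Explicit n X Y) : Explicit n X Y' where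
  Z := a.Z
  finite_Z := a.finite_Z
  W := a.W
  p := a.p
  etale_p := a.etale_p
  s := a.s
  s_p := a.s_p
  φ := a.φ
  zeroLocus_φ := a.zeroLocus_φ
  g := a.g ≫ f.left
  g_over := by rw [Category.assoc, Over.w, a.g_over]

theorem Rel.postcomp (f : Y ⟶ Y') {a b : Explicit n X Y} (r : Rel a b) :
    Rel (a.postcomp f) (b.postcomp f) := by
  obtain ⟨h, V, hV, hφ, hg⟩ := r
  have := congr($hg ≫ f.left)
  rw [Category.assoc, Category.assoc, Category.assoc, Category.assoc] at this
  exact ⟨h, V, hV, hφ, this⟩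

/-- The copy in `W` of a closed subset `Z'` of `A^n_X` (that is, `s(Z ∩ Z')`). -/
def copy (a : Explicit n X Y) (Z' : Closeds (Aff n X.left)) : Closeds a.W :=
  ⟨a.p ⁻¹' Z' ∩ a.W.zeroLocus (Set.range a.φ),
    (Z'.isClosed.preimage a.p.continuous).inter (Scheme.zeroLocus_isClosed _ _)⟩

/-- The open complement of `s(Z ∩ Z')` in `W`. -/
def away (a : Explicit n X Y) (Z' : Closeds (Aff n X.left)) : a.W.Opens := (a.copy Z').compl

theorem isClosedImmersion_redIncl {A : Scheme.{u}} {Z' Z : Closeds A} (h : Z' ≤ Z) :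
    IsClosedImmersion (redIncl h) := by
  have : IsClosedImmersion (redIncl h ≫ redι Z) := by rw [redIncl_ι]; infer_instance
  exact .of_comp _ (redι Z)

theorem p_s_apply (a : Explicit n X Y) (y : Red a.Z) : a.p (a.s y) = redι a.Z y := by
  rw [← Scheme.Hom.comp_apply, a.s_p]

theorem redι_mem {A : Scheme.{u}} (Z : Closeds A) (y : Red Z) : redι Z y ∈ Z := by
  have : redι Z y ∈ Set.range (redι Z) := ⟨y, rfl⟩
  rwa [range_redι] at this

theorem mem_away (a : Explicit n X Y) (Z' : Closeds (Aff n X.left)) (w : a.W) :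
    w ∈ a.away Z' ↔ ¬ (a.p w ∈ Z' ∧ w ∈ Set.range a.s) := by
  rw [← a.zeroLocus_φ]
  exact Iff.rfl

theorem range_part_subset (a : Explicit n X Y) (Z₁ Z₂ : Closeds (Aff n X.left))
    (hd : Disjoint (Z₁ : Set (Aff n X.left)) Z₂) (hZ : Z₁ ⊔ Z₂ = a.Z) :
    Set.range (redIncl (hZ ▸ le_sup_left : Z₁ ≤ a.Z) ≫ a.s) ⊆ Set.range (a.away Z₂).ι := by
  rintro _ ⟨y, rfl⟩
  rw [Scheme.Opens.range_ι]
  refine (mem_away a Z₂ _).2 fun h ↦ ?_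
  have h1 := h.1
  rw [← Scheme.Hom.comp_apply, Category.assoc, a.s_p, redIncl_ι] at h1
  exact Set.disjoint_left.1 hd (redι_mem Z₁ y) h1

/-- If the support of `a` is the disjoint union of the closed subsets `Z₁` and `Z₂`, this is the
explicit framed correspondence with support `Z₁` obtained by removing (the copy of) `Z₂` from the
étale neighbourhood. -/
@[simps]
def part (a : Explicit n X Y) (Z₁ Z₂ : Closeds (Aff n X.left))
    (hd : Disjoint (Z₁ : Set (Aff n X.left)) Z₂)
    (hZ : Z₁ ⊔ Z₂ = a.Z) : Explicit n X Y where
  Z := Z₁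
  finite_Z := by
    have := isClosedImmersion_redIncl (hZ ▸ le_sup_left : Z₁ ≤ a.Z)
    rw [← redIncl_ι (hZ ▸ le_sup_left : Z₁ ≤ a.Z), Category.assoc]
    infer_instance
  W := a.away Z₂
  p := (a.away Z₂).ι ≫ a.p
  etale_p := inferInstance
  s := IsOpenImmersion.lift (a.away Z₂).ι (redIncl (hZ ▸ le_sup_left) ≫ a.s)
    (range_part_subset a Z₁ Z₂ hd hZ)
  s_p := by rw [IsOpenImmersion.lift_fac_assoc, Category.assoc, a.s_p, redIncl_ι]
  φ i := (a.away Z₂).ι.appTop (a.φ i)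
  zeroLocus_φ := by
    have h := Scheme.preimage_zeroLocus (a.away Z₂).ι (Set.range a.φ)
    rw [a.zeroLocus_φ, ← Set.range_comp] at h
    refine h.symm.trans (Set.Subset.antisymm ?_ ?_)
    · rintro w ⟨z, hz⟩
      have hw := (mem_away a Z₂ _).1 w.2
      have hpz : a.p w.1 = redι a.Z z := by rw [← p_s_apply]; exact congrArg a.p hz.symm
      have hz1 : redι a.Z z ∈ Z₁ := by
        have h1 : redι a.Z z ∈ Z₁ ⊔ Z₂ := by rw [hZ]; exact redι_mem a.Z z
        rcases h1 with h1 | h1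
        · exact h1
        · exact (hw ⟨by rw [← hpz] at h1; exact h1, z, hz⟩).elim
      have hz2 : redι a.Z z ∈ Set.range (redι Z₁) := by rw [range_redι]; exact hz1
      obtain ⟨y, hy⟩ := hz2
      refine ⟨y, (a.away Z₂).ι.injective ?_⟩
      rw [← Scheme.Hom.comp_apply, IsOpenImmersion.lift_fac, Scheme.Hom.comp_apply]
      refine Eq.trans (congrArg a.s ((redι a.Z).injective ?_)) hz
      rw [← Scheme.Hom.comp_apply, redIncl_ι, hy]
    · rintro _ ⟨y, rfl⟩
      refine ⟨redIncl (hZ ▸ le_sup_left : Z₁ ≤ a.Z) y, ?_⟩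
      rw [← Scheme.Hom.comp_apply, ← Scheme.Hom.comp_apply, IsOpenImmersion.lift_fac]
  g := (a.away Z₂).ι ≫ a.g
  g_over := by simp [a.g_over]

theorem Rel.part_precomp (f : X' ⟶ X) (a : Explicit n X Y) (Z₁ Z₂ : Closeds (Aff n X.left))
    (hd : Disjoint (Z₁ : Set (Aff n X.left)) Z₂) (hZ : Z₁ ⊔ Z₂ = a.Z)
    (hd' : Disjoint (Z₁.preimage (affMap n f.left).continuous : Set (Aff n X'.left))
      (Z₂.preimage (affMap n f.left).continuous))
    (hZ' : Z₁.preimage (affMap n f.left).continuous ⊔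
      Z₂.preimage (affMap n f.left).continuous = (a.precomp f).Z) :
    Rel ((a.part Z₁ Z₂ hd hZ).precomp f) ((a.precomp f).part _ _ hd' hZ') := by
  let F := affMap n f.left
  let e₀ : pullback ((a.away Z₂).ι ≫ a.p) F ⟶ pullback a.p F :=
    pullback.lift (pullback.fst _ _ ≫ (a.away Z₂).ι) (pullback.snd _ _)
      (by rw [Category.assoc, pullback.condition])
  have e1 : e₀ ≫ pullback.fst _ _ = pullback.fst _ _ ≫ (a.away Z₂).ι := pullback.lift_fst _ _ _
  have e2 : e₀ ≫ pullback.snd _ _ = pullback.snd _ _ := pullback.lift_snd _ _ _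
  let A : (pullback a.p F).Opens := (a.precomp f).away (Z₂.preimage F.continuous)
  have hr : Set.range e₀ ⊆ Set.range A.ι := by
    rintro _ ⟨x, rfl⟩
    rw [Scheme.Opens.range_ι]
    refine (mem_away (a.precomp f) _ _).2 ?_
    rintro ⟨h1, h2⟩
    change e₀ x ∈ Set.range (precompSection f a) at h2
    rw [← preimage_range_s] at h2
    change F (pullback.snd a.p F (e₀ x)) ∈ Z₂ at h1
    change pullback.fst a.p F (e₀ x) ∈ Set.range a.s at h2
    have h3 := (mem_away a Z₂ _).1 (pullback.fst ((a.away Z₂).ι ≫ a.p) F x).2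
    rw [← Scheme.Hom.comp_apply, ← Scheme.Hom.comp_apply, ← pullback.condition,
      reassoc_of% e1] at h1
    rw [← Scheme.Hom.comp_apply, e1] at h2
    exact h3 ⟨h1, h2⟩
  let e : pullback ((a.away Z₂).ι ≫ a.p) F ⟶ A := IsOpenImmersion.lift A.ι e₀ hr
  have he : e ≫ A.ι = e₀ := IsOpenImmersion.lift_fac _ _ _
  refine Rel.of_hom rfl e ?_ ?_ (fun i ↦ ?_) ?_
  · change e ≫ A.ι ≫ pullback.snd a.p F = pullback.snd _ _
    rw [reassoc_of% he, e2]
  · let q : Red (Z₁.preimage F.continuous) ⟶ pullback ((a.away Z₂).ι ≫ a.p) F :=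
      precompSection f (a.part Z₁ Z₂ hd hZ)
    have hl : Z₁ ≤ a.Z := hZ ▸ le_sup_left
    have hl' : Z₁.preimage F.continuous ≤ a.Z.preimage F.continuous := fun x hx ↦ hl hx
    have q1 : q ≫ pullback.fst _ _ = redMap F le_rfl ≫
        IsOpenImmersion.lift (a.away Z₂).ι (redIncl hl ≫ a.s) (range_part_subset a Z₁ Z₂ hd hZ) :=
      precompSection_fst f (a.part Z₁ Z₂ hd hZ)
    have q2 : q ≫ pullback.snd _ _ = redι _ := precompSection_snd f (a.part Z₁ Z₂ hd hZ)
    have hr' : Set.range (redIncl hl' ≫ precompSection f a) ⊆ Set.range A.ι :=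
      range_part_subset (a.precomp f) _ _ hd' hZ'
    refine (?_ : q ≫ e = redIncl (le_refl (Z₁.preimage F.continuous)) ≫
      IsOpenImmersion.lift A.ι (redIncl hl' ≫ precompSection f a) hr')
    have hi : redIncl hl' ≫ redMap F (Z := a.Z) le_rfl =
        redMap F (Z := Z₁) le_rfl ≫ redIncl hl := by
      rw [← cancel_mono (redι a.Z), Category.assoc, redMap_ι, Category.assoc, redIncl_ι, redMap_ι,
        ← Category.assoc, redIncl_ι]
    have hid : redIncl (le_refl (Z₁.preimage F.continuous)) = 𝟙 _ := by
      rw [← cancel_mono (redι _), redIncl_ι, Category.id_comp]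
    rw [hid, Category.id_comp, ← cancel_mono A.ι, Category.assoc, he, IsOpenImmersion.lift_fac]
    apply pullback.hom_ext
    · rw [Category.assoc, e1, reassoc_of% q1, IsOpenImmersion.lift_fac, Category.assoc,
        precompSection_fst, reassoc_of% hi]
    · rw [Category.assoc, e2, q2, Category.assoc, precompSection_snd, redIncl_ι]
  · change e.appTop (A.ι.appTop ((pullback.fst a.p F).appTop (a.φ i))) =
      (pullback.fst ((a.away Z₂).ι ≫ a.p) F).appTop ((a.away Z₂).ι.appTop (a.φ i))
    rw [← CommRingCat.comp_apply, ← CommRingCat.comp_apply, ← CommRingCat.comp_apply,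
      ← Scheme.Hom.comp_appTop, ← Scheme.Hom.comp_appTop, ← Scheme.Hom.comp_appTop,
      he, e1]
  · change e ≫ A.ι ≫ pullback.fst a.p F ≫ a.g =
      pullback.fst ((a.away Z₂).ι ≫ a.p) F ≫ (a.away Z₂).ι ≫ a.g
    rw [reassoc_of% he, reassoc_of% e1]

end Explicit

/-! ### Framed correspondences and linear framed correspondences -/

/-- `Fr_n(X, Y)`: framed correspondences of level `n`, that is, equivalence classes of explicit
ones. -/
def Fr (n : ℕ) (X Y : Over S) : Type (u + 1) := Quot (Explicit.Rel (n := n) (X := X) (Y := Y))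

/-- The class of an explicit framed correspondence in `Fr_n(X, Y)`. -/
def Fr.mk {n : ℕ} {X Y : Over S} (a : Explicit n X Y) : Fr n X Y := Quot.mk _ a

theorem Fr.sound {n : ℕ} {X Y : Over S} {a b : Explicit n X Y} (h : Explicit.Rel a b) :
    Fr.mk a = Fr.mk b :=
  Quot.sound h

/-- Precomposition of framed correspondences with a morphism `f : X' ⟶ X`. -/
def Fr.precomp {n : ℕ} {X X' : Over S} (f : X' ⟶ X) (Y : Over S) (a : Fr n X Y) : Fr n X' Y :=
  Quot.map (Explicit.precomp f) (fun _ _ ↦ Explicit.Rel.precomp f) a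

/-- Composition of framed correspondences with a morphism `f : Y ⟶ Y'`. -/
def Fr.postcomp {n : ℕ} (X : Over S) {Y Y' : Over S} (f : Y ⟶ Y') (a : Fr n X Y) : Fr n X Y' :=
  Quot.map (Explicit.postcomp f) (fun _ _ ↦ Explicit.Rel.postcomp f) a

/-- The subgroup of `ℤFr_n(X, Y)` generated by the elements `a - a₁ - a₂`, where the support of
`a` is a disjoint union `Z₁ ⊔ Z₂` of closed subsets and `aᵢ` is the part of `a` at `Zᵢ`. -/
def additivity (n : ℕ) (X Y : Over S) : AddSubgroup (FreeAbelianGroup (Fr n X Y)) :=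
  AddSubgroup.closure {x | ∃ (a : Explicit n X Y) (Z₁ Z₂ : Closeds (Aff n X.left))
    (hd : Disjoint (Z₁ : Set (Aff n X.left)) Z₂) (hZ : Z₁ ⊔ Z₂ = a.Z),
    x = .of (.mk a) - .of (.mk (a.part Z₁ Z₂ hd hZ)) -
      .of (.mk (a.part Z₂ Z₁ hd.symm (by rw [sup_comm, hZ])))}

/-- `ℤF_n(X, Y)`. -/
abbrev ZF (n : ℕ) (X Y : Over S) : Type (u + 1) :=
  FreeAbelianGroup (Fr n X Y) ⧸ additivity n X Y

/-- The class `⟨a⟩` in `ℤF_n(X, Y)` of a framed correspondence `a`. -/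
def ZF.of {n : ℕ} {X Y : Over S} (a : Fr n X Y) : ZF n X Y :=
  QuotientAddGroup.mk (FreeAbelianGroup.of a)

/-- Precomposition with a morphism `f : X' ⟶ X`, as a homomorphism `ℤF_n(X, Y) → ℤF_n(X', Y)`. -/
def ZF.precomp (n : ℕ) {X X' : Over S} (f : X' ⟶ X) (Y : Over S) : ZF n X Y →+ ZF n X' Y :=
  QuotientAddGroup.map _ _ (FreeAbelianGroup.map (Fr.precomp f Y)) (by
    rw [additivity, AddSubgroup.closure_le]
    rintro _ ⟨a, Z₁, Z₂, hd, hZ, rfl⟩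
    have hd' := hd.preimage (affMap n f.left)
    have hZ' : Z₁.preimage (affMap n f.left).continuous ⊔
        Z₂.preimage (affMap n f.left).continuous = (a.precomp f).Z := by
      rw [Explicit.precomp_Z, ← hZ]; rfl
    have h₁ := Fr.sound (Explicit.Rel.part_precomp f a Z₁ Z₂ hd hZ hd' hZ')
    have h₂ := Fr.sound (Explicit.Rel.part_precomp f a Z₂ Z₁ hd.symm (by rw [sup_comm, hZ])
      hd'.symm (by rw [sup_comm, hZ']))
    refine AddSubgroup.subset_closure ⟨a.precomp f, _, _, hd', hZ', ?_⟩
    rw [map_sub, map_sub, FreeAbelianGroup.map_of_apply, FreeAbelianGroup.map_of_apply,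
      FreeAbelianGroup.map_of_apply]
    rw [← h₁, ← h₂]
    rfl)

/-- Composition with a morphism `f : Y ⟶ Y'`, as a homomorphism `ℤF_n(X, Y) → ℤF_n(X, Y')`. -/
def ZF.postcomp (n : ℕ) (X : Over S) {Y Y' : Over S} (f : Y ⟶ Y') : ZF n X Y →+ ZF n X Y' :=
  QuotientAddGroup.map _ _ (FreeAbelianGroup.map (Fr.postcomp X f)) (by
    rw [additivity, AddSubgroup.closure_le]
    rintro _ ⟨a, Z₁, Z₂, hd, hZ, rfl⟩
    refine AddSubgroup.subset_closure ⟨a.postcomp f, Z₁, Z₂, hd, hZ, ?_⟩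
    rw [map_sub, map_sub, FreeAbelianGroup.map_of_apply, FreeAbelianGroup.map_of_apply,
      FreeAbelianGroup.map_of_apply]
    have key : ∀ (Z Z' : Closeds (Aff n X.left)) (hd) (hZ : Z ⊔ Z' = a.Z),
        (a.part Z Z' hd hZ).postcomp f = (a.postcomp f).part Z Z' hd hZ := by
      intro Z Z' hd hZ
      unfold Explicit.part Explicit.postcomp
      simp only [Category.assoc]
      rfl
    change FreeAbelianGroup.of (Fr.mk _) - FreeAbelianGroup.of (Fr.mk _) -
      FreeAbelianGroup.of (Fr.mk _) = _
    rw [key, key])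

/-! ### Homotopies -/

/-- `A^1 × X`. -/
def A1Prod (X : Over S) : Over S := Over.mk (affProj 1 X.left ≫ X.hom)

/-- The section `X ⟶ A^1 × X` at the point `0` of `A^1`. -/
def zeroSec (X : Over S) : X ⟶ A1Prod X :=
  Over.homMk (AffineSpace.homOfVector (𝟙 X.left) (fun _ ↦ 0)) (by simp [A1Prod])

/-- The section `X ⟶ A^1 × X` at the point `1` of `A^1`. -/
def oneSec (X : Over S) : X ⟶ A1Prod X :=
  Over.homMk (AffineSpace.homOfVector (𝟙 X.left) (fun _ ↦ 1)) (by simp [A1Prod])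

/-- The homomorphism `i₀^* - i₁^* : ℤF_n(A^1 × X, Y) → ℤF_n(X, Y)`. -/
def ZF.homotopyDiff (n : ℕ) (X Y : Over S) : ZF n (A1Prod X) Y →+ ZF n X Y :=
  ZF.precomp n (zeroSec X) Y - ZF.precomp n (oneSec X) Y

/-- The group of `A^1`-homotopy classes: the cokernel of `i₀^* - i₁^*`. -/
abbrev ZFbar (n : ℕ) (X Y : Over S) : Type (u + 1) := ZF n X Y ⧸ (ZF.homotopyDiff n X Y).range

/-- The class `[a]` of `a ∈ ℤF_n(X, Y)` modulo homotopy. -/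
def ZFbar.mk {n : ℕ} {X Y : Over S} (a : ZF n X Y) : ZFbar n X Y := QuotientAddGroup.mk a

theorem ZF.postcomp_precomp (n : ℕ) {X X' Y Y' : Over S} (f : X' ⟶ X) (g : Y ⟶ Y')
    (a : ZF n X Y) :
    ZF.postcomp n X' g (ZF.precomp n f Y a) = ZF.precomp n f Y' (ZF.postcomp n X g a) := by
  suffices (ZF.postcomp n X' g).comp (ZF.precomp n f Y) =
      (ZF.precomp n f Y').comp (ZF.postcomp n X g) from DFunLike.congr_fun this a
  refine QuotientAddGroup.addMonoidHom_ext _ (FreeAbelianGroup.lift_ext _ _ ?_)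
  rintro ⟨a⟩
  have key : (a.precomp f).postcomp g = (a.postcomp g).precomp f := by
    unfold Explicit.precomp Explicit.postcomp
    simp only [Category.assoc]
    rfl
  change ZF.of (Fr.mk _) = ZF.of (Fr.mk _)
  rw [key]

/-- Composition of homotopy classes with (the class of) a morphism `g : Y ⟶ Y'`. -/
def ZFbar.postcomp (n : ℕ) (X : Over S) {Y Y' : Over S} (g : Y ⟶ Y') :
    ZFbar n X Y →+ ZFbar n X Y' :=
  QuotientAddGroup.map _ _ (ZF.postcomp n X g) (by
    rintro _ ⟨h, rfl⟩
    refine ⟨ZF.postcomp n (A1Prod X) g h, ?_⟩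
    simp only [ZF.homotopyDiff, AddMonoidHom.sub_apply, map_sub, ZF.postcomp_precomp])

/-! ### The suspension morphism -/

/-- `t`, the coordinate of `A^1_X`. -/
abbrev coord (X : Scheme.{u}) : Γ(Aff 1 X, ⊤) := AffineSpace.coord X ⟨0⟩

theorem finite_zeroLocus_coord (X : Scheme.{u}) :
    IsFinite (redι (⟨(Aff 1 X).zeroLocus (Set.range fun _ : Fin 1 ↦ coord X),
      Scheme.zeroLocus_isClosed _ _⟩ : Closeds (Aff 1 X)) ≫ affProj 1 X) := by
  set Z : Closeds (Aff 1 X) := ⟨(Aff 1 X).zeroLocus (Set.range fun _ : Fin 1 ↦ coord X),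
      Scheme.zeroLocus_isClosed _ _⟩ with hZdef
  let o : X ⟶ Aff 1 X := AffineSpace.homOfVector (𝟙 X) (fun _ ↦ 0)
  have ho : o ≫ affProj 1 X = 𝟙 X := AffineSpace.homOfVector_over _ _
  have : IsClosedImmersion (o ≫ affProj 1 X) := by rw [ho]; infer_instance
  have : IsClosedImmersion o := .of_comp o (affProj 1 X)
  have hsub : (Z : Set (Aff 1 X)) ⊆ o.ker.support := by
    refine Set.Subset.trans ?_ (Scheme.Hom.range_subset_ker_support o)
    intro x hx
    have hx' : x ∉ (Aff 1 X).basicOpen (coord X) :=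
      (Scheme.mem_zeroLocus_iff _ _ _).1 hx _ ⟨0, rfl⟩
    let i := (Aff 1 X).fromSpecResidueField x
    have h0 : i.appTop (coord X) = 0 := by
      have hb : i ⁻¹ᵁ (Aff 1 X).basicOpen (coord X) = ⊥ := by
        refine Opens.ext (Set.eq_empty_iff_forall_notMem.2 fun y hy ↦ hx' ?_)
        have hyx : i y ∈ Set.range i := ⟨y, rfl⟩
        simp only [i, Scheme.range_fromSpecResidueField, Set.mem_singleton_iff] at hyx
        rw [← hyx]
        exact hy
      rw [Scheme.preimage_basicOpen] at hb
      exact eq_zero_of_basicOpen_eq_bot _ hb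
    have hi : i = (i ≫ affProj 1 X) ≫ o := by
      apply AffineSpace.hom_ext
      · rw [Category.assoc, ho, Category.comp_id]
      · rintro ⟨j⟩
        obtain rfl : j = 0 := Subsingleton.elim _ _
        rw [Scheme.Hom.comp_appTop, CommRingCat.comp_apply, AffineSpace.homOfVector_appTop_coord,
          map_zero]
        exact h0
    have : x ∈ Set.range i := by simp [i, Scheme.range_fromSpecResidueField]
    obtain ⟨y, hy⟩ := this
    rw [hi, Scheme.Hom.comp_apply] at hy
    exact ⟨_, hy⟩
  let l : Red Z ⟶ X := IsClosedImmersion.lift o (redι Z) (by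
    rw [Scheme.IdealSheafData.ker_subschemeι]
    exact Scheme.IdealSheafData.le_support_iff_le_vanishingIdeal.1 hsub)
  have hl : l ≫ o = redι Z := IsClosedImmersion.lift_fac _ _ _
  have : IsClosedImmersion (l ≫ o) := by rw [hl]; infer_instance
  have : IsClosedImmersion l := .of_comp l o
  rw [← hl, Category.assoc, ho, Category.comp_id]
  infer_instance

/-- The explicit framed correspondence `(X × 0, X × A^1, t; pr_X)`. -/
@[simps]
def sigmaExplicit (X : Over S) : Explicit 1 X X where
  Z := ⟨(Aff 1 X.left).zeroLocus (Set.range fun _ : Fin 1 ↦ coord X.left),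
    Scheme.zeroLocus_isClosed _ _⟩
  finite_Z := finite_zeroLocus_coord X.left
  W := Aff 1 X.left
  p := 𝟙 _
  etale_p := inferInstance
  s := redι _
  s_p := Category.comp_id _
  φ _ := coord X.left
  zeroLocus_φ := by rw [range_redι]; rfl
  g := affProj 1 X.left
  g_over := by simp

/-- `σ_X ∈ ℤF_1(X, X)`. -/
def sigma (X : Over S) : ZF 1 X X := ZF.of (Fr.mk (sigmaExplicit X))

/-! ### Open subsets of the affine line -/

/-- An open subset of the affine line over a field `k`, as a `k`-scheme. -/
def openInLine (k : Type u) [Field k] (U : (Aff 1 (Spec (.of k))).Opens) :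
    Over (Spec (CommRingCat.of k)) :=
  Over.mk (U.ι ≫ affProj 1 (Spec (.of k)))

/-- The inclusion of open subsets of the affine line. -/
def openIncl {k : Type u} [Field k] {V U : (Aff 1 (Spec (.of k))).Opens} (h : V ≤ U) :
    openInLine k V ⟶ openInLine k U :=
  Over.homMk ((Aff 1 (Spec (.of k))).homOfLE h) (by simp [openInLine])

end FramedTransfers

/-! The ring `k[t]` is principal, so `U` and `V` are the loci `D(a)` and `D(ab)` for nonzero coprime
`a`, `b` (`exists_eq_lineOpen`). Let `R = Γ(U)`, let `x ∈ R` be the coordinate, and let `X` be the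
coordinate of `A^1_U`. If `P` is monic over `R`, its zero locus is finite over `U`. If moreover `P`
is coprime to `Q · c(g)`, then `P`, the framing `PQ` and the morphism `g` define a correspondence
`⟨P, Q, g⟩` from `U` to `D(c)` (`ofPoly`). Everything reduces to identities between such triples.

The Chinese remainder theorem provides monic `H₁`, `H₂` with `H₁ ≡ 1` mod `ab`, `(X - x)H₂ ≡ 1` mod
`a`, `H₂ ≡ 1` mod `b(X - x)` and `deg H₁ = deg H₂ + 1` (`exists_frame_polynomials`). The zeros of
`H₁` and of `H₂` then avoid those of `ab`, so `r = ⟨H₁, 1, X⟩ - ⟨H₂, X - x, X⟩` takes values in `V`.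

In `U` only the zeros of `a` have to be avoided. The segment from `H₁` to `(X - x)H₂` stays monic
and congruent to `1` mod `a`, so it is a homotopy `⟨H₁, 1, X⟩ ∼ ⟨(X - x)H₂, 1, X⟩`
(`mk_ofPoly_eq_of_degree_lt`). Since `X - x` and `H₂` are coprime, the right side is `⟨X - x, H₂, X⟩
+ ⟨H₂, X - x, X⟩` (`zf_ofPoly_mul`), and the last term cancels in `i ∘ r`.

What remains is supported on the graph of `x`, where `H₂` is `1`. Sliding the graph to the zero
section, while deforming `H₂` to `1` and `g = X` to the constant polynomial `x`, turns it into `⟨X,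
1, x⟩ = σ_U` (`mk_ofPoly_X_eq`). -/

namespace FramedTransfers

universe u

/-! ### Framing polynomials from the Chinese remainder theorem -/

section

open Polynomial

/-- The monic polynomials `H₁` and `H₂` framing the two summands of the correspondence to the
complement of the zeros of `a * b`. -/
theorem exists_frame_polynomials {k R : Type*} [Field k] [CommRing R] [Nontrivial R] (κ : k →+* R)
    (x : R) {a b : k[X]} (ha : a ≠ 0) (hb : b ≠ 0) (hab : IsCoprime a b)
    (hx : IsUnit (a.eval₂ κ x)) :
    ∃ H₁ H₂ : R[X], H₁.Monic ∧ H₂.Monic ∧ H₁.degree = ((X - C x) * H₂).degree ∧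
      (a * b).map κ ∣ H₁ - 1 ∧ a.map κ ∣ (X - C x) * H₂ - 1 ∧ b.map κ * (X - C x) ∣ H₂ - 1 := by
  classical
  -- Over the field `k` normalizing changes `a` and `b` only by units, and the resulting polynomials
  -- remain monic over `R`.
  have hA : (normalize a).Monic := Polynomial.monic_normalize ha
  have hB : (normalize b).Monic := Polynomial.monic_normalize hb
  have hdA : a.map κ ∣ (normalize a).map κ := Polynomial.map_dvd κ (dvd_normalize_iff.2 dvd_rfl)
  have hdB : b.map κ ∣ (normalize b).map κ := Polynomial.map_dvd κ (dvd_normalize_iff.2 dvd_rfl)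
  have hMA := hA.map κ
  have hMB := hB.map κ
  have hMD := hMB.mul (monic_X_sub_C x)
  -- Modulo `X - x` the polynomial `a` is the unit `a(x)`. Nothing similar holds for `b(x)`, so `b`
  -- and `X - x` enter only through their product `D`.
  have hcx : IsCoprime (a.map κ) (X - C x) := by
    obtain ⟨q, hq⟩ := X_sub_C_dvd_sub_C_eval (p := a.map κ) (a := x)
    rw [Polynomial.eval_map] at hq
    obtain ⟨u, hu⟩ := hx
    refine ⟨C (↑u⁻¹ : R), -C (↑u⁻¹ : R) * q, ?_⟩
    rw [sub_eq_iff_eq_add] at hq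
    rw [hq, ← hu, mul_add, ← C_mul, Units.inv_mul, C_1]
    ring
  have hcb : IsCoprime (a.map κ) (b.map κ) := hab.map (mapRingHom κ)
  have hAa : (normalize a).map κ ∣ a.map κ := Polynomial.map_dvd κ (normalize_dvd_iff.2 dvd_rfl)
  have hBb : (normalize b).map κ ∣ b.map κ := Polynomial.map_dvd κ (normalize_dvd_iff.2 dvd_rfl)
  have hcD : IsCoprime ((normalize a).map κ) ((normalize b).map κ * (X - C x)) :=
    ((hcb.of_isCoprime_of_dvd_right hBb).mul_right hcx).of_isCoprime_of_dvd_left hAa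
  obtain ⟨u, v, huv⟩ := hcx.of_isCoprime_of_dvd_left hAa
  obtain ⟨p, q, hpq⟩ := hcD
  generalize (normalize a).map κ = A at *
  generalize hD : (normalize b).map κ * (X - C x) = D at *
  -- Chinese remainder: `H₀ ≡ 1` mod `D` and `H₀ ≡ v` mod `A`, where `v` is an inverse of `X - x`
  -- mod `A`.
  set H₀ := p * A + q * D * v with hH₀
  have hAD : (A * D).Monic := hMA.mul hMD
  -- Adding `A D X ^ N` preserves both congruences and, for this `N`, dominates `H₀`, so that the
  -- sum is monic.
  set N := H₀.natDegree + 1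
  have hlt : H₀.degree < (A * D * X ^ N).degree := by
    have h1 := (hAD.mul (monic_X_pow N))
    rw [degree_eq_natDegree h1.ne_zero, hAD.natDegree_mul (monic_X_pow N), natDegree_X_pow]
    refine degree_le_natDegree.trans_lt ?_
    norm_cast
    omega
  have hM2 : (A * D * X ^ N + H₀).Monic := (hAD.mul (monic_X_pow N)).add_of_left hlt
  have hd2 : (A * D * X ^ N + H₀).degree = (A * D * X ^ N).degree :=
    degree_add_eq_left_of_degree_lt hlt
  have hB1 : ((1 : R[X])).degree < (A * D * X ^ (N + 1)).degree := by
    have h1 := (hAD.mul (monic_X_pow (N + 1)))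
    rw [degree_eq_natDegree h1.ne_zero, hAD.natDegree_mul (monic_X_pow _), natDegree_X_pow,
      degree_one]
    norm_cast
    omega
  -- The exponent `N + 1` compensates for the factor `X - x` on the other side of the degree
  -- equality.
  refine ⟨A * D * X ^ (N + 1) + 1, A * D * X ^ N + H₀,
    (hAD.mul (monic_X_pow _)).add_of_left hB1, hM2, ?_, ?_, ?_, ?_⟩
  · rw [degree_add_eq_left_of_degree_lt hB1, hM2.degree_mul, hd2, pow_succ, ← mul_assoc,
      (monic_X).degree_mul, degree_X, degree_X_sub_C, add_comm]
  · rw [add_sub_cancel_right, Polynomial.map_mul]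
    exact ((mul_dvd_mul hdA (hdB.trans ⟨_, hD.symm⟩))).trans ⟨_, rfl⟩
  · refine hdA.trans ⟨(X - C x) * (D * X ^ N + p - p * v) - u, ?_⟩
    rw [hH₀]
    linear_combination ((X - C x) * v) * hpq + huv
  · refine (mul_dvd_mul_right hdB _).trans ⟨A * X ^ N - q + q * v, ?_⟩
    rw [hD, hH₀]
    linear_combination hpq

end

/-! ### Functions on `k`-schemes and morphisms to the line -/

variable {k : Type u} [Field k]

/-- The structure map from the base field to the global functions on a `k`-scheme. -/
def constHom (T : Over (Spec (CommRingCat.of k))) : k →+* Γ(T.left, ⊤) :=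
  ((Scheme.ΓSpecIso (.of k)).inv ≫ T.hom.appTop).hom

theorem appTop_constHom {T' T : Over (Spec (CommRingCat.of k))} (f : T' ⟶ T) (c : k) :
    f.left.appTop (constHom T c) = constHom T' c := by
  have := Over.w f
  rw [constHom, constHom, ← this, Scheme.Hom.comp_appTop]
  rfl

/-- Evaluation of a polynomial over the base field at a function on a `k`-scheme. -/
def evalFun (T : Over (Spec (CommRingCat.of k))) (γ : Γ(T.left, ⊤)) :
    Polynomial k →+* Γ(T.left, ⊤) :=
  Polynomial.eval₂RingHom (constHom T) γ

theorem appTop_evalFun {T' T : Over (Spec (CommRingCat.of k))} (f : T' ⟶ T) (γ : Γ(T.left, ⊤))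
    (a : Polynomial k) : f.left.appTop (evalFun T γ a) = evalFun T' (f.left.appTop γ) a := by
  simp only [evalFun, Polynomial.coe_eval₂RingHom]
  refine (Polynomial.hom_eval₂ a (constHom T) f.left.appTop.hom γ).trans ?_
  congr 1
  ext c
  exact appTop_constHom f c

variable (k) in
/-- The affine line as a `k`-scheme. -/
abbrev line : Over (Spec (CommRingCat.of k)) := Over.mk (affProj 1 (Spec (.of k)))

/-- The morphism to the affine line given by a function. -/
def toLine (T : Over (Spec (CommRingCat.of k))) (γ : Γ(T.left, ⊤)) : T ⟶ line k :=
  Over.homMk (AffineSpace.homOfVector T.hom fun _ ↦ γ) (AffineSpace.homOfVector_over _ _)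

@[simp]
theorem toLine_appTop_coord (T : Over (Spec (CommRingCat.of k))) (γ : Γ(T.left, ⊤)) :
    (toLine T γ).left.appTop (coord (Spec (.of k))) = γ :=
  AffineSpace.homOfVector_appTop_coord _ _ _

theorem hom_line_ext {T : Over (Spec (CommRingCat.of k))} {f g : T ⟶ line k}
    (h : f.left.appTop (coord (Spec (.of k))) = g.left.appTop (coord (Spec (.of k)))) :
    f = g := by
  ext1
  refine AffineSpace.hom_ext ((Over.w f).trans (Over.w g).symm) ?_
  rintro ⟨i⟩
  obtain rfl : i = 0 := Subsingleton.elim _ _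
  exact h

theorem comp_toLine {T' T : Over (Spec (CommRingCat.of k))} (f : T' ⟶ T) (γ : Γ(T.left, ⊤)) :
    f ≫ toLine T γ = toLine T' (f.left.appTop γ) := by
  refine hom_line_ext ?_
  rw [toLine_appTop_coord, Over.comp_left, Scheme.Hom.comp_appTop, CommRingCat.comp_apply,
    toLine_appTop_coord]

variable (k) in
/-- The open subset of the affine line where a polynomial does not vanish. -/
def lineOpen (a : Polynomial k) : (Aff 1 (Spec (CommRingCat.of k))).Opens :=
  (Aff 1 (Spec (.of k))).basicOpen (evalFun (line k) (coord (Spec (.of k))) a)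

theorem preimage_toLine (T : Over (Spec (CommRingCat.of k))) (γ : Γ(T.left, ⊤))
    (a : Polynomial k) :
    (toLine T γ).left ⁻¹ᵁ (lineOpen k a) = T.left.basicOpen (evalFun T γ a) := by
  rw [lineOpen]
  refine (Scheme.preimage_basicOpen _ _).trans ?_
  change T.left.basicOpen ((toLine T γ).left.appTop _) = _
  rw [appTop_evalFun, toLine_appTop_coord]

/-! ### Polynomial functions on `A^1_X` and finiteness of supports -/

/-- Evaluation of a polynomial over the functions on `X` at the coordinate of the affine line
over `X`. -/
def polyEval (X : Scheme.{u}) : Polynomial Γ(X, ⊤) →+* Γ(Aff 1 X, ⊤) :=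
  Polynomial.eval₂RingHom (affProj 1 X).appTop.hom (coord X)

@[simp]
theorem polyEval_X (X : Scheme.{u}) : polyEval X .X = coord X := by simp [polyEval]

@[simp]
theorem polyEval_C (X : Scheme.{u}) (c : Γ(X, ⊤)) :
    polyEval X (.C c) = (affProj 1 X).appTop c := by
  rw [polyEval, Polynomial.coe_eval₂RingHom, Polynomial.eval₂_C]

theorem appTop_polyEval {X' X : Scheme.{u}} (f : X' ⟶ X) (P : Polynomial Γ(X, ⊤)) :
    (affMap 1 f).appTop (polyEval X P) = polyEval X' (P.map f.appTop.hom) := by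
  simp only [polyEval, Polynomial.coe_eval₂RingHom, Polynomial.eval₂_map]
  refine (Polynomial.hom_eval₂ P _ (affMap 1 f).appTop.hom _).trans ?_
  congr 1
  · ext c
    have := congr($(AffineSpace.map_over (n := ULift (Fin 1)) f).appTop c)
    rw [Scheme.Hom.comp_appTop, Scheme.Hom.comp_appTop] at this
    exact this
  · exact AffineSpace.map_appTop_coord _ _

/-- For affine `X` the affine line is the spectrum of a polynomial ring, here in variables indexed
by the one-element type `ULift (Fin 1)`; induction on multivariate polynomials passes to one
variable. -/
theorem polyEval_surjective (X : Scheme.{u}) [IsAffine X] :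
    Function.Surjective (polyEval X) := by
  have h : Function.Surjective (MvPolynomial.eval₂Hom (affProj 1 X).appTop.hom
      (AffineSpace.coord X : ULift (Fin 1) → _)) := by
    have h1 := AffineSpace.isoOfIsAffine_hom_appTop (n := ULift (Fin 1)) X
    intro y
    let e := AffineSpace.isoOfIsAffine (ULift (Fin 1)) X
    refine ⟨(Scheme.ΓSpecIso _).hom (e.inv.appTop y), ?_⟩
    have h2 : e.hom.appTop (e.inv.appTop y) = y := by
      rw [← CommRingCat.comp_apply, ← Scheme.Hom.comp_appTop, e.hom_inv_id]
      simp
    rw [h1] at h2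
    exact h2
  intro y
  obtain ⟨p, rfl⟩ := h y
  change _ ∈ (polyEval X).range
  induction p using MvPolynomial.induction_on with
  | C c => exact ⟨.C c, by simp⟩
  | add p q hp hq => rw [map_add]; exact add_mem hp hq
  | mul_X p i hp =>
    rw [map_mul]
    refine mul_mem hp ⟨.X, ?_⟩
    obtain ⟨i⟩ := i
    obtain rfl : i = 0 := Subsingleton.elim _ _
    simp

/-- A closed subset of the affine line over an affine scheme on which a monic polynomial vanishes
is finite over the base. -/
theorem isFinite_of_monic {X : Scheme.{u}} [IsAffine X] (Z : Closeds (Aff 1 X))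
    {P : Polynomial Γ(X, ⊤)} (hP : P.Monic)
    (hZ : (Z : Set (Aff 1 X)) ⊆ (Aff 1 X).zeroLocus {polyEval X P}) :
    IsFinite (redι Z ≫ affProj 1 X) := by
  obtain ⟨h1, h2⟩ := IsClosedImmersion.isAffine_surjective_of_isAffine (redι Z)
  -- Pointwise vanishing on an affine scheme gives nilpotence. This suffices, since powers of `P`
  -- are monic too.
  have h0 : IsNilpotent ((redι Z).appTop (polyEval X P)) := by
    rw [Scheme.isNilpotent_iff_basicOpen_eq_bot, ← Scheme.preimage_basicOpen_top]
    refine Opens.ext (Set.eq_empty_iff_forall_notMem.2 fun y hy ↦ ?_)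
    have := hZ (Explicit.redι_mem Z y)
    rw [Scheme.mem_zeroLocus_iff] at this
    exact this _ rfl hy
  obtain ⟨n, hn⟩ := h0
  refine ((@HasAffineProperty.iff_of_isAffine @IsFinite _
    IsFinite.instHasAffinePropertyAndIsAffineFiniteCarrierObjOppositeOpensCarrierCarrierCommRingCatPresheafOpOpensTopHomAppTop
    _ _ _ _)).2 ⟨h1, ?_⟩
  let φ := ((redι Z).appTop.hom.comp (polyEval X))
  have hφ : Function.Surjective φ := h2.comp (polyEval_surjective X)
  have hc : (redι Z ≫ affProj 1 X).appTop.hom = φ.comp Polynomial.C := by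
    ext c
    rw [Scheme.Hom.comp_appTop]
    exact congrArg (redι Z).appTop (polyEval_C X c).symm
  have hP0 : φ (P ^ n) = 0 := (map_pow φ P n).trans hn
  rw [hc]
  -- The functions on `Z` form a quotient of `Γ(X)[T] / (P ^ n)`, a finite `Γ(X)`-module.
  have := (hP.pow n).finite_adjoinRoot
  have hq : Function.Surjective (AdjoinRoot.lift (φ.comp Polynomial.C) (φ .X) (f := P ^ n) (by
      rw [← hP0, ← Polynomial.hom_eval₂, Polynomial.eval₂_C_X])) := by
    intro y
    obtain ⟨p, rfl⟩ := hφ y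
    refine ⟨AdjoinRoot.mk _ p, ?_⟩
    rw [AdjoinRoot.lift_mk, ← Polynomial.hom_eval₂, Polynomial.eval₂_C_X]
  have hf : (AdjoinRoot.of (P ^ n)).Finite := RingHom.finite_algebraMap.2 this
  have := (RingHom.Finite.of_surjective _ hq).comp hf
  rwa [AdjoinRoot.lift_comp_of] at this

/-! ### Correspondences given by global functions on `A^1_X` -/

theorem redIncl_refl {A : Scheme.{u}} (Z : Closeds A) : redIncl (le_refl Z) = 𝟙 _ := by
  rw [← cancel_mono (redι _), redIncl_ι, Category.id_comp]

/-- The affine line over a `k`-scheme `X`, as a `k`-scheme. -/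
abbrev lineOver (X : Over (Spec (CommRingCat.of k))) : Over (Spec (CommRingCat.of k)) :=
  Over.mk (affProj 1 X.left ≫ X.hom)

/-- The morphism `A^1_{X'} ⟶ A^1_X` over `k` induced by `f : X' ⟶ X`. -/
abbrev lineOverMap {X' X : Over (Spec (CommRingCat.of k))} (f : X' ⟶ X) :
    lineOver X' ⟶ lineOver X :=
  Over.homMk (affMap 1 f.left) (by simp)

/-- A framed correspondence of level one from `X` to an open subset `Y` of the affine line which
is given by global functions: its étale neighbourhood is an open subset `W` of `A^1_X`, its
framing is the restriction of a function `F` on `A^1_X` and its morphism to the line is the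
restriction of a function `γ` on `A^1_X`. -/
structure LineData (X : Over (Spec (CommRingCat.of k)))
    (Y : (Aff 1 (Spec (CommRingCat.of k))).Opens) where
  /-- the framing -/
  F : Γ(Aff 1 X.left, ⊤)
  /-- the function defining the morphism to the line -/
  γ : Γ(Aff 1 X.left, ⊤)
  /-- the support -/
  Z : Closeds (Aff 1 X.left)
  /-- the open neighbourhood of the support -/
  W : (Aff 1 X.left).Opens
  finite_Z : IsFinite (redι Z ≫ affProj 1 X.left)
  Z_eq : (Z : Set (Aff 1 X.left)) = (Aff 1 X.left).zeroLocus {F} ∩ W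
  W_le : W ≤ (toLine (lineOver X) γ).left ⁻¹ᵁ Y

namespace LineData

variable {X X' : Over (Spec (CommRingCat.of k))} {Y Y' : (Aff 1 (Spec (CommRingCat.of k))).Opens}

theorem Z_le_W (d : LineData X Y) : (d.Z : Set (Aff 1 X.left)) ⊆ d.W := by
  rw [d.Z_eq]; exact Set.inter_subset_right

theorem range_redι_subset (d : LineData X Y) : Set.range (redι d.Z) ⊆ Set.range d.W.ι := by
  rw [range_redι, Scheme.Opens.range_ι]; exact d.Z_le_W

theorem range_subset (d : LineData X Y) :
    Set.range (d.W.ι ≫ (toLine (lineOver X) d.γ).left) ⊆ Set.range Y.ι := by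
  rw [Scheme.Opens.range_ι]
  rintro _ ⟨y, rfl⟩
  exact d.W_le y.2

/-- The section over the support. -/
def sec (d : LineData X Y) : Red d.Z ⟶ d.W :=
  IsOpenImmersion.lift d.W.ι (redι d.Z) d.range_redι_subset

theorem sec_ι (d : LineData X Y) : d.sec ≫ d.W.ι = redι d.Z := IsOpenImmersion.lift_fac _ _ _

/-- The morphism to the target. -/
def target (d : LineData X Y) : (d.W : Scheme) ⟶ Y :=
  IsOpenImmersion.lift Y.ι (d.W.ι ≫ (toLine (lineOver X) d.γ).left) d.range_subset

theorem target_ι (d : LineData X Y) :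
    d.target ≫ Y.ι = d.W.ι ≫ (toLine (lineOver X) d.γ).left := IsOpenImmersion.lift_fac _ _ _

/-- The explicit framed correspondence given by global functions. -/
def toExplicit (d : LineData X Y) : Explicit 1 X (openInLine k Y) where
  Z := d.Z
  finite_Z := d.finite_Z
  W := d.W
  p := d.W.ι
  etale_p := inferInstance
  s := d.sec
  s_p := d.sec_ι
  φ _ := d.W.ι.appTop d.F
  zeroLocus_φ := by
    have h := Scheme.preimage_zeroLocus d.W.ι (U := ⊤) {d.F}
    rw [Set.image_singleton] at h
    rw [Set.range_const]
    refine h.symm.trans (Set.ext fun w ↦ ⟨fun hw ↦ ?_, ?_⟩)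
    · have : d.W.ι w ∈ Set.range (redι d.Z) := by
        rw [range_redι, d.Z_eq]
        exact ⟨hw, w.2⟩
      obtain ⟨z, hz⟩ := this
      refine ⟨z, d.W.ι.injective ?_⟩
      rw [← Scheme.Hom.comp_apply, sec_ι, hz]
    · rintro ⟨z, rfl⟩
      change d.W.ι (d.sec z) ∈ (Aff 1 X.left).zeroLocus {d.F}
      rw [← Scheme.Hom.comp_apply, sec_ι]
      have := Explicit.redι_mem d.Z z
      rw [← SetLike.mem_coe, d.Z_eq] at this
      exact this.1
  g := d.target
  g_over := by
    change d.target ≫ Y.ι ≫ _ = _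
    rw [← Category.assoc, target_ι, Category.assoc]
    congr 1
    exact Over.w (toLine (lineOver X) d.γ)

/-- The framed correspondence given by global functions. -/
def fr (d : LineData X Y) : Fr 1 X (openInLine k Y) := Fr.mk d.toExplicit

/-- The morphism in `ℤF_1` given by global functions. -/
def zf (d : LineData X Y) : ZF 1 X (openInLine k Y) := ZF.of d.fr

theorem rel_of_le (d d' : LineData X Y) (hF : d.F = d'.F) (hγ : d.γ = d'.γ) (hZ : d.Z = d'.Z)
    (hW : d.W ≤ d'.W) : Explicit.Rel d.toExplicit d'.toExplicit := by
  have he : (Aff 1 X.left).homOfLE hW ≫ d'.W.ι = d.W.ι := Scheme.homOfLE_ι _ _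
  have hs : d.sec ≫ (Aff 1 X.left).homOfLE hW = redIncl hZ.le ≫ d'.sec := by
    rw [← cancel_mono d'.W.ι, Category.assoc, he, sec_ι, Category.assoc, sec_ι, redIncl_ι]
  refine Explicit.Rel.of_hom hZ ((Aff 1 X.left).homOfLE hW) he hs (fun i ↦ ?_) ?_
  · change ((Aff 1 X.left).homOfLE hW).appTop (d'.W.ι.appTop d'.F) = d.W.ι.appTop d.F
    rw [← CommRingCat.comp_apply, ← Scheme.Hom.comp_appTop, he, hF]
  · change (Aff 1 X.left).homOfLE hW ≫ d'.target = d.target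
    rw [← cancel_mono Y.ι, Category.assoc, target_ι, target_ι, reassoc_of% he, hγ]

/-- The framed correspondence does not depend on the neighbourhood of the support. -/
theorem fr_eq (d d' : LineData X Y) (hF : d.F = d'.F) (hγ : d.γ = d'.γ) (hZ : d.Z = d'.Z) :
    d.fr = d'.fr := by
  -- Both neighbourhoods contain the common support, so both correspondences restrict to the
  -- intersection.
  let e : LineData X Y :=
    { d with
      W := d.W ⊓ d'.W
      Z_eq := by
        refine Set.Subset.antisymm (fun z hz ↦ ⟨(d.Z_eq ▸ hz).1, d.Z_le_W hz, ?_⟩) ?_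
        · rw [hZ] at hz; exact d'.Z_le_W hz
        · rintro z ⟨h1, h2⟩
          rw [d.Z_eq]
          exact ⟨h1, h2.1⟩
      W_le := inf_le_left.trans d.W_le }
  exact (Fr.sound (rel_of_le e d rfl rfl rfl inf_le_left)).symm.trans
    (Fr.sound (rel_of_le e d' hF hγ hZ inf_le_right))

theorem zf_eq (d d' : LineData X Y) (hF : d.F = d'.F) (hγ : d.γ = d'.γ) (hZ : d.Z = d'.Z) :
    d.zf = d'.zf := congrArg ZF.of (fr_eq d d' hF hγ hZ)

/-- The base change of correspondences given by global functions. -/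
def pull (f : X' ⟶ X) (d : LineData X Y) : LineData X' Y where
  F := (affMap 1 f.left).appTop d.F
  γ := (affMap 1 f.left).appTop d.γ
  Z := d.Z.preimage (affMap 1 f.left).continuous
  W := (affMap 1 f.left) ⁻¹ᵁ d.W
  finite_Z := (d.toExplicit.precomp f).finite_Z
  Z_eq := by
    have h := Scheme.preimage_zeroLocus (affMap 1 f.left) (U := ⊤) {d.F}
    rw [Set.image_singleton] at h
    refine Eq.trans ?_ (congrArg (· ∩ _) h)
    change (affMap 1 f.left) ⁻¹' d.Z = _
    rw [d.Z_eq]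
    rfl
  W_le := by
    have h := comp_toLine (lineOverMap f) d.γ
    have h' : affMap 1 f.left ≫ (toLine (lineOver X) d.γ).left =
      (toLine (lineOver X') ((affMap 1 f.left).appTop d.γ)).left := congrArg (·.left) h
    rw [← h']
    exact fun x hx ↦ d.W_le hx

/-- The preimage of `W` maps to the fibre product `W ×_{A^1_X} A^1_{X'}` compatibly with all data.
By `Explicit.Rel.of_hom` a morphism in one direction is enough, so no inverse is constructed. -/
theorem precomp_fr (f : X' ⟶ X) (d : LineData X Y) :
    Fr.precomp f (openInLine k Y) d.fr = (d.pull f).fr := by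
  refine (Fr.sound (?_ : Explicit.Rel (d.pull f).toExplicit (d.toExplicit.precomp f))).symm
  let A := affMap 1 f.left
  have hr : (A ∣_ d.W) ≫ d.W.ι = (A ⁻¹ᵁ d.W).ι ≫ A := morphismRestrict_ι A d.W
  let e : ((A ⁻¹ᵁ d.W : (Aff 1 X'.left).Opens) : Scheme) ⟶ pullback d.W.ι A :=
    pullback.lift (A ∣_ d.W) (A ⁻¹ᵁ d.W).ι hr
  have e1 : e ≫ pullback.fst d.W.ι A = A ∣_ d.W := pullback.lift_fst _ _ _
  have e2 : e ≫ pullback.snd d.W.ι A = (A ⁻¹ᵁ d.W).ι := pullback.lift_snd _ _ _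
  let σ : Red (d.Z.preimage A.continuous) ⟶ (A ⁻¹ᵁ d.W : (Aff 1 X'.left).Opens) := (d.pull f).sec
  let q : Red (d.Z.preimage A.continuous) ⟶ pullback d.W.ι A :=
    Explicit.precompSection f d.toExplicit
  let τ : ((A ⁻¹ᵁ d.W : (Aff 1 X'.left).Opens) : Scheme) ⟶ Y := (d.pull f).target
  have hσ : σ ≫ (A ⁻¹ᵁ d.W).ι = redι _ := (d.pull f).sec_ι
  have q1 : q ≫ pullback.fst d.W.ι A = redMap A le_rfl ≫ d.sec :=
    Explicit.precompSection_fst f d.toExplicit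
  have q2 : q ≫ pullback.snd d.W.ι A = redι _ := Explicit.precompSection_snd f d.toExplicit
  have hτ : τ ≫ Y.ι = (A ⁻¹ᵁ d.W).ι ≫ (toLine (lineOver X') (A.appTop d.γ)).left :=
    (d.pull f).target_ι
  have hs : σ ≫ e = q := by
    apply pullback.hom_ext
    · rw [Category.assoc, e1, q1, ← cancel_mono d.W.ι, Category.assoc, hr, Category.assoc, sec_ι,
        redMap_ι, reassoc_of% hσ]
    · rw [Category.assoc, e2, q2, hσ]
  have hq : redIncl (le_refl (d.Z.preimage A.continuous)) ≫ q = q := by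
    rw [redIncl_refl, Category.id_comp]
  have hg : e ≫ pullback.fst d.W.ι A ≫ d.target = τ := by
    have h : A ≫ (toLine (lineOver X) d.γ).left =
      (toLine (lineOver X') (A.appTop d.γ)).left :=
      congrArg (·.left) (comp_toLine (lineOverMap f) d.γ)
    rw [reassoc_of% e1, ← cancel_mono Y.ι, Category.assoc, target_ι, hτ, reassoc_of% hr, h]
  refine Explicit.Rel.of_hom rfl e e2 (hs.trans hq.symm) (fun i ↦ ?_) hg
  change e.appTop ((pullback.fst d.W.ι A).appTop (d.W.ι.appTop d.F)) =
    (A ⁻¹ᵁ d.W).ι.appTop (A.appTop d.F)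
  rw [← CommRingCat.comp_apply, ← CommRingCat.comp_apply, ← CommRingCat.comp_apply,
    ← Scheme.Hom.comp_appTop, ← Scheme.Hom.comp_appTop, ← Scheme.Hom.comp_appTop,
    Category.assoc, reassoc_of% e1, hr]

theorem precomp_zf (f : X' ⟶ X) (d : LineData X Y) :
    ZF.precomp 1 f (openInLine k Y) d.zf = (d.pull f).zf :=
  congrArg ZF.of (precomp_fr f d)

/-- Correspondences given by global functions with values in a smaller open subset of the line,
considered with values in a larger one. -/
def enlarge (h : Y ≤ Y') (d : LineData X Y) : LineData X Y' where
  __ := d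
  W_le := d.W_le.trans fun _ hx ↦ h hx

/-- Both morphisms to `Y'` agree after the monomorphism into the line, so the explicit
correspondences are equal, not merely equivalent. -/
theorem postcomp_zf (h : Y ≤ Y') (d : LineData X Y) :
    ZF.postcomp 1 X (openIncl h) d.zf = (d.enlarge h).zf := by
  refine congrArg ZF.of (congrArg Fr.mk (?_ : d.toExplicit.postcomp (openIncl h) =
    (d.enlarge h).toExplicit))
  have h1 : (d.target ≫ (Aff 1 (Spec (.of k))).homOfLE h) ≫ Y'.ι =
      d.W.ι ≫ (toLine (lineOver X) d.γ).left := by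
    rw [Category.assoc, Scheme.homOfLE_ι, target_ι]
  have : d.target ≫ (Aff 1 (Spec (.of k))).homOfLE h = (d.enlarge h).target :=
    (cancel_mono Y'.ι).1 (h1.trans (d.enlarge h).target_ι.symm)
  unfold Explicit.postcomp toExplicit
  simp only [← this]
  rfl

/-- The part of a correspondence given by global functions at a closed subset of its support. -/
def restrict (d : LineData X Y) (Z₁ Z₂ : Closeds (Aff 1 X.left))
    (hd : Disjoint (Z₁ : Set (Aff 1 X.left)) Z₂) (hZ : Z₁ ⊔ Z₂ = d.Z) : LineData X Y where
  F := d.F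
  γ := d.γ
  Z := Z₁
  W := d.W ⊓ Z₂.compl
  finite_Z := (d.toExplicit.part Z₁ Z₂ hd hZ).finite_Z
  Z_eq := by
    have h : (Z₁ : Set (Aff 1 X.left)) ∪ Z₂ = (Aff 1 X.left).zeroLocus {d.F} ∩ d.W := by
      rw [← d.Z_eq, ← hZ]; rfl
    refine Set.ext fun z ↦ ⟨fun hz ↦ ?_, fun hz ↦ ?_⟩
    · have := h.le (Or.inl hz)
      exact ⟨this.1, this.2, Set.disjoint_left.1 hd hz⟩
    · exact (h.ge ⟨hz.1, hz.2.1⟩).resolve_right hz.2.2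
  W_le := inf_le_left.trans d.W_le

/-- `Explicit.part` removes from `W` the copy of `Z₂`, while `restrict` intersects `W` with the
complement of `Z₂` in `A^1_X`. These match because `Z₂` lies in the support, so each point of `W`
over `Z₂` is in the image of the section. -/
theorem rel_part (d : LineData X Y) (Z₁ Z₂ : Closeds (Aff 1 X.left))
    (hd : Disjoint (Z₁ : Set (Aff 1 X.left)) Z₂) (hZ : Z₁ ⊔ Z₂ = d.Z) :
    Explicit.Rel (d.toExplicit.part Z₁ Z₂ hd hZ) (d.restrict Z₁ Z₂ hd hZ).toExplicit := by
  let B : (d.W : Scheme).Opens := d.toExplicit.away Z₂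
  let D := d.restrict Z₁ Z₂ hd hZ
  have hr : Set.range (B.ι ≫ d.W.ι) ⊆ Set.range D.W.ι := by
    rw [Scheme.Opens.range_ι]
    rintro _ ⟨y, rfl⟩
    refine ⟨y.1.2, fun hy ↦ ?_⟩
    refine (Explicit.mem_away d.toExplicit Z₂ y.1).1 y.2 ⟨hy, ?_⟩
    have h1 : d.W.ι y.1 ∈ d.Z := by rw [← hZ]; exact Or.inr hy
    rw [← SetLike.mem_coe, ← range_redι] at h1
    obtain ⟨z, hz⟩ := h1
    refine ⟨z, d.W.ι.injective ?_⟩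
    change d.W.ι (d.sec z) = _
    rw [← Scheme.Hom.comp_apply, sec_ι, hz]
  let e : (B : Scheme) ⟶ D.W := IsOpenImmersion.lift D.W.ι (B.ι ≫ d.W.ι) hr
  have he : e ≫ D.W.ι = B.ι ≫ d.W.ι := IsOpenImmersion.lift_fac _ _ _
  let σ : Red Z₁ ⟶ B := (d.toExplicit.part Z₁ Z₂ hd hZ).s
  have hσ : σ ≫ B.ι ≫ d.W.ι = redι Z₁ := (d.toExplicit.part Z₁ Z₂ hd hZ).s_p
  have hD : D.sec ≫ D.W.ι = redι Z₁ := D.sec_ι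
  have hs : σ ≫ e = D.sec :=
    (cancel_mono D.W.ι).1 (by rw [Category.assoc, he, hσ]; exact hD.symm)
  have hq : redIncl (le_refl Z₁) ≫ D.sec = D.sec := by
    erw [redIncl_refl, Category.id_comp]
  have hg : e ≫ D.target = B.ι ≫ d.target := by
    rw [← cancel_mono Y.ι, Category.assoc, target_ι, Category.assoc, target_ι, reassoc_of% he]
    rfl
  refine Explicit.Rel.of_hom rfl e he (hs.trans hq.symm) (fun i ↦ ?_) hg
  change e.appTop (D.W.ι.appTop d.F) = B.ι.appTop (d.W.ι.appTop d.F)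
  rw [← CommRingCat.comp_apply, ← CommRingCat.comp_apply,
    ← Scheme.Hom.comp_appTop, ← Scheme.Hom.comp_appTop, he]

theorem zf_eq_add (d : LineData X Y) (Z₁ Z₂ : Closeds (Aff 1 X.left))
    (hd : Disjoint (Z₁ : Set (Aff 1 X.left)) Z₂) (hZ : Z₁ ⊔ Z₂ = d.Z) :
    d.zf = (d.restrict Z₁ Z₂ hd hZ).zf +
      (d.restrict Z₂ Z₁ hd.symm (by rw [sup_comm, hZ])).zf := by
  have h₁ := Fr.sound (rel_part d Z₁ Z₂ hd hZ)
  have h₂ := Fr.sound (rel_part d Z₂ Z₁ hd.symm (by rw [sup_comm, hZ]))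
  rw [← sub_eq_zero, ← sub_sub]
  refine (QuotientAddGroup.eq_zero_iff _).2
    (AddSubgroup.subset_closure ⟨d.toExplicit, Z₁, Z₂, hd, hZ, ?_⟩)
  rw [h₁, h₂]
  rfl

end LineData

/-! ### The suspension as a correspondence given by global functions -/

/-- The coordinate function on an open subset of the line. -/
def openCoord (U : (Aff 1 (Spec (CommRingCat.of k))).Opens) : Γ((openInLine k U).left, ⊤) :=
  U.ι.appTop (coord (Spec (.of k)))

theorem toLine_openCoord (U : (Aff 1 (Spec (CommRingCat.of k))).Opens) :
    (toLine (openInLine k U) (openCoord U)).left = U.ι := by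
  let i : openInLine k U ⟶ line k := Over.homMk U.ι
  have : toLine (openInLine k U) (openCoord U) = i := hom_line_ext (toLine_appTop_coord _ _)
  rw [this]
  rfl

theorem toLine_lineOver_openCoord (U : (Aff 1 (Spec (CommRingCat.of k))).Opens) :
    (toLine (lineOver (openInLine k U))
      ((affProj 1 (openInLine k U).left).appTop (openCoord U))).left =
      affProj 1 (openInLine k U).left ≫ U.ι := by
  let i : lineOver (openInLine k U) ⟶ openInLine k U := Over.homMk (affProj 1 _)
  rw [← toLine_openCoord]
  exact (congrArg (·.left) (comp_toLine i (openCoord U))).symm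

/-- The suspension correspondence of an open subset of the line. -/
def sigmaData (U : (Aff 1 (Spec (CommRingCat.of k))).Opens) : LineData (openInLine k U) U where
  F := coord _
  γ := (affProj 1 (openInLine k U).left).appTop (openCoord U)
  Z := (sigmaExplicit (openInLine k U)).Z
  W := ⊤
  finite_Z := (sigmaExplicit (openInLine k U)).finite_Z
  Z_eq := by
    change Scheme.zeroLocus _ (Set.range fun _ : Fin 1 ↦ _) = _
    rw [Set.range_const]
    simp
  W_le := by
    rw [toLine_lineOver_openCoord]
    intro z _
    exact (affProj 1 (openInLine k U).left z).2

theorem sigma_eq (U : (Aff 1 (Spec (CommRingCat.of k))).Opens) :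
    sigma (openInLine k U) = (sigmaData U).zf := by
  refine (congrArg ZF.of (Fr.sound ?_)).symm
  let X := openInLine k U
  let W : (Aff 1 X.left).Opens := ⊤
  let τ : (W : Scheme) ⟶ U := (sigmaData U).target
  have hτ : τ ≫ U.ι = W.ι ≫ affProj 1 X.left ≫ U.ι :=
    (sigmaData U).target_ι.trans (congrArg (W.ι ≫ ·) (toLine_lineOver_openCoord U))
  let p : Aff 1 X.left ⟶ U := affProj 1 X.left
  have hg : W.ι ≫ p = τ := by
    rw [← cancel_mono U.ι, hτ, Category.assoc]
    rfl
  have hs : redIncl (le_refl (sigmaExplicit X).Z) ≫ redι (sigmaExplicit X).Z =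
    redι (sigmaExplicit X).Z := redIncl_ι _
  exact Explicit.Rel.of_hom rfl W.ι (Category.comp_id _) ((sigmaData U).sec_ι.trans hs.symm)
    (fun i ↦ rfl) hg

/-! ### Open subsets of the line as non-vanishing loci of polynomials -/

theorem evalFun_lineOver (X : Over (Spec (CommRingCat.of k))) (g : Polynomial Γ(X.left, ⊤))
    (a : Polynomial k) :
    evalFun (lineOver X) (polyEval X.left g) a =
      polyEval X.left (a.eval₂ (Polynomial.C.comp (constHom X)) g) := by
  rw [Polynomial.hom_eval₂]
  change a.eval₂ _ _ = _
  congr 1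
  ext c
  change _ = polyEval X.left (.C (constHom X c))
  rw [polyEval_C]
  let p : lineOver X ⟶ X := Over.homMk (affProj 1 X.left)
  exact (appTop_constHom p c).symm

theorem evalFun_line_surjective :
    Function.Surjective (evalFun (line k) (coord (Spec (CommRingCat.of k)))) := by
  intro y
  obtain ⟨P, rfl⟩ := polyEval_surjective _ y
  let e := (Scheme.ΓSpecIso (CommRingCat.of k)).commRingCatIsoToRingEquiv
  refine ⟨P.map e.toRingHom, ?_⟩
  rw [evalFun, Polynomial.coe_eval₂RingHom, Polynomial.eval₂_map]
  change Polynomial.eval₂ _ _ P = Polynomial.eval₂ _ _ P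
  congr 1
  ext c
  exact congrArg (affProj 1 (Spec (.of k))).appTop (e.symm_apply_apply c)

theorem lineOpen_mul (a b : Polynomial k) : lineOpen k (a * b) = lineOpen k a ⊓ lineOpen k b := by
  rw [lineOpen, map_mul, Scheme.basicOpen_mul]
  rfl

/-- The polynomials which vanish on the complement of an open subset of the line. -/
def complIdeal (U : (Aff 1 (Spec (CommRingCat.of k))).Opens) : Ideal (Polynomial k) where
  carrier := {a | lineOpen k a ≤ U}
  add_mem' {a b} ha hb := by
    change lineOpen k (a + b) ≤ U
    rw [lineOpen, map_add]
    exact (Scheme.basicOpen_add_le _ _ _).trans (sup_le ha hb)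
  zero_mem' := by
    change lineOpen k 0 ≤ U
    rw [lineOpen, map_zero, Scheme.basicOpen_zero]
    exact bot_le
  smul_mem' c a ha := by
    change lineOpen k (c * a) ≤ U
    rw [lineOpen_mul]
    exact inf_le_right.trans ha

theorem mem_complIdeal {U : (Aff 1 (Spec (CommRingCat.of k))).Opens} {a : Polynomial k} :
    a ∈ complIdeal U ↔ lineOpen k a ≤ U := Iff.rfl

/-- Basic opens form a basis of the affine line, and each is some `D(p)` since all global functions
are polynomials. If `D(p) ⊆ U` then `a ∣ p`, whence `D(p) ⊆ D(a)`. -/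
theorem lineOpen_of_span {U : (Aff 1 (Spec (CommRingCat.of k))).Opens} {a : Polynomial k}
    (h : complIdeal U = Ideal.span {a}) : U = lineOpen k a := by
  refine le_antisymm (fun x hx ↦ ?_) ?_
  · obtain ⟨_, ⟨_, ⟨f, rfl⟩, rfl⟩, hxf, hf⟩ :=
      (isBasis_basicOpen (Aff 1 (Spec (CommRingCat.of k)))).exists_subset_of_mem_open hx U.2
    obtain ⟨p, rfl⟩ := evalFun_line_surjective f
    have hp : p ∈ complIdeal U := hf
    rw [h, Ideal.mem_span_singleton] at hp
    obtain ⟨q, rfl⟩ := hp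
    have : x ∈ lineOpen k (a * q) := hxf
    rw [lineOpen_mul] at this
    exact this.1
  · rw [← mem_complIdeal, h]
    exact Ideal.mem_span_singleton_self a

/-- Nested non-empty open subsets of the line are the non-vanishing loci of `a` and `a * b` for
coprime non-zero polynomials `a` and `b`. -/
theorem exists_eq_lineOpen {U V : (Aff 1 (Spec (CommRingCat.of k))).Opens} (hVU : V ≤ U)
    (hV : (V : Set (Aff 1 (Spec (CommRingCat.of k)))).Nonempty) :
    ∃ a b : Polynomial k, a ≠ 0 ∧ b ≠ 0 ∧ IsCoprime a b ∧ U = lineOpen k a ∧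
      V = lineOpen k (a * b) := by
  obtain ⟨a, ha⟩ := (IsPrincipalIdealRing.principal (complIdeal U)).principal
  obtain ⟨f, hf⟩ := (IsPrincipalIdealRing.principal (complIdeal V)).principal
  have hUa := lineOpen_of_span ha
  have hVf := lineOpen_of_span hf
  have haf : a ∣ f := by
    rw [← Ideal.mem_span_singleton]
    refine ha.le (mem_complIdeal.2 ?_)
    rwa [← hVf]
  obtain ⟨b, rfl⟩ := haf
  have h0 : a * b ≠ 0 := by
    intro h
    obtain ⟨x, hx⟩ := hV
    rw [hVf, h, lineOpen, map_zero, Scheme.basicOpen_zero] at hx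
    exact hx
  -- As `D(p ^ n) = D(p)` for `n > 0`, the ideal of `V` is radical. Its generator `a * b` is
  -- therefore squarefree, which makes `a` and `b` coprime.
  have hr : IsRadical (a * b) := by
    intro n p hp
    rw [← Ideal.mem_span_singleton] at hp ⊢
    have hp' : p ^ n ∈ complIdeal V := hf.ge hp
    refine hf.le (mem_complIdeal.2 ?_)
    rcases n.eq_zero_or_pos with rfl | hn
    · rw [mem_complIdeal, pow_zero, lineOpen, map_one, Scheme.basicOpen_one] at hp'
      exact le_top.trans hp'
    · rwa [mem_complIdeal, lineOpen, map_pow, Scheme.basicOpen_pow _ _ hn] at hp'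
  exact ⟨a, b, left_ne_zero_of_mul h0, right_ne_zero_of_mul h0,
    (squarefree_mul_iff.1 (hr.squarefree h0)).1.isCoprime, hUa, hVf⟩

instance isAffine_openInLine (a : Polynomial k) : IsAffine (openInLine k (lineOpen k a)).left :=
  (isAffineOpen_top (Aff 1 (Spec (CommRingCat.of k)))).basicOpen _

theorem isUnit_evalFun_openCoord (a : Polynomial k) :
    IsUnit (a.eval₂ (constHom (openInLine k (lineOpen k a))) (openCoord (lineOpen k a))) := by
  let X := openInLine k (lineOpen k a)
  change IsUnit (evalFun X (openCoord (lineOpen k a)) a)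
  refine X.left.toRingedSpace.isUnit_of_isUnit_germ ⊤ _ fun x hx ↦ ?_
  refine (Scheme.mem_basicOpen_top X.left _ x).1 ?_
  rw [← preimage_toLine, toLine_openCoord]
  exact x.2

instance isAffine_A1Prod (X : Over (Spec (CommRingCat.of k))) [IsAffine X.left] :
    IsAffine (A1Prod X).left := inferInstanceAs (IsAffine (Aff 1 X.left))

/-! ### Correspondences given by monic polynomials -/

namespace LineData

open Polynomial

variable {X X' : Over (Spec (CommRingCat.of k))}

/-- In a relation `u P + v Q = 1` the two terms cannot vanish at the same point. All geometric
conditions on supports are checked through such coprimality. -/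
theorem basicOpen_polyEval_of_isCoprime {P Q : Γ(X.left, ⊤)[X]} (h : IsCoprime P Q) :
    (Aff 1 X.left).zeroLocus {polyEval X.left P} ⊆
      (Aff 1 X.left).basicOpen (polyEval X.left Q) := by
  obtain ⟨u, v, huv⟩ := h
  intro z hz
  rw [Scheme.zeroLocus_singleton] at hz
  have h1 := Scheme.basicOpen_add_le (Aff 1 X.left) (polyEval X.left (u * P))
    (polyEval X.left (v * Q))
  rw [← map_add, huv, map_one, Scheme.basicOpen_one, map_mul, map_mul, Scheme.basicOpen_mul,
    Scheme.basicOpen_mul] at h1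
  rcases h1 (Opens.mem_top z) with h | h
  · exact (hz h.2).elim
  · exact h.2

theorem basicOpen_mul_le_preimage_toLine (c : k[X]) (Q g : Γ(X.left, ⊤)[X]) :
    (Aff 1 X.left).basicOpen (polyEval X.left (Q * c.eval₂ (C.comp (constHom X)) g)) ≤
      (toLine (lineOver X) (polyEval X.left g)).left ⁻¹ᵁ lineOpen k c := by
  have h : (toLine (lineOver X) (polyEval X.left g)).left ⁻¹ᵁ lineOpen k c =
      (Aff 1 X.left).basicOpen (polyEval X.left (c.eval₂ (C.comp (constHom X)) g)) :=
    (preimage_toLine (lineOver X) _ c).trans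
      (congrArg (Aff 1 X.left).basicOpen (evalFun_lineOver X g c))
  rw [h, map_mul, Scheme.basicOpen_mul]
  exact inf_le_right

theorem map_eval₂_C_comp_constHom (f : X' ⟶ X) (c : k[X]) (g : Γ(X.left, ⊤)[X]) :
    (c.eval₂ (C.comp (constHom X)) g).map f.left.appTop.hom =
      c.eval₂ (C.comp (constHom X')) (g.map f.left.appTop.hom) := by
  rw [← coe_mapRingHom, hom_eval₂]
  congr 1
  ext1 r
  simp only [RingHom.comp_apply, coe_mapRingHom, map_C]
  exact congrArg C (appTop_constHom f r)

theorem isCoprime_map (f : X' ⟶ X) {c : k[X]} {P Q g : Γ(X.left, ⊤)[X]}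
    (h : IsCoprime P (Q * c.eval₂ (C.comp (constHom X)) g)) :
    IsCoprime (P.map f.left.appTop.hom) (Q.map f.left.appTop.hom *
      c.eval₂ (C.comp (constHom X')) (g.map f.left.appTop.hom)) := by
  rw [← map_eval₂_C_comp_constHom, ← Polynomial.map_mul]
  exact h.map (mapRingHom f.left.appTop.hom)

variable [IsAffine X.left]

/-- The correspondence whose support is the zero locus of a monic polynomial `P`, with framing
`P * Q` and morphism to the line given by `g`. -/
def ofPoly (c : k[X]) (P Q g : Γ(X.left, ⊤)[X]) (hP : P.Monic)
    (h : IsCoprime P (Q * c.eval₂ (C.comp (constHom X)) g)) : LineData X (lineOpen k c) where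
  F := polyEval X.left (P * Q)
  γ := polyEval X.left g
  Z := ⟨(Aff 1 X.left).zeroLocus {polyEval X.left P}, Scheme.zeroLocus_isClosed _ _⟩
  -- Inverting `Q` discards the zeros of `P * Q` outside `Z(P)`; inverting `c(g)` makes `g` land in
  -- `D(c)`.
  W := (Aff 1 X.left).basicOpen (polyEval X.left (Q * c.eval₂ (C.comp (constHom X)) g))
  finite_Z := isFinite_of_monic _ hP subset_rfl
  Z_eq := by
    refine Set.Subset.antisymm
      (fun z hz ↦ ⟨?_, basicOpen_polyEval_of_isCoprime h hz⟩) fun z hz ↦ ?_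
    · change z ∈ Scheme.zeroLocus _ _ at hz
      rw [Scheme.zeroLocus_singleton] at hz ⊢
      rw [map_mul, Scheme.basicOpen_mul]
      exact fun h ↦ hz h.1
    · obtain ⟨h1, h2⟩ := hz
      rw [Scheme.zeroLocus_singleton, map_mul, Scheme.basicOpen_mul] at h1
      rw [map_mul, Scheme.basicOpen_mul] at h2
      change z ∈ Scheme.zeroLocus _ _
      rw [Scheme.zeroLocus_singleton]
      exact fun h ↦ h1 ⟨h, h2.1⟩
  W_le := basicOpen_mul_le_preimage_toLine c Q g

/-- Serves to rewrite `P`, `Q` and `g`, on which the proof arguments of `ofPoly` depend. -/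
theorem zf_ofPoly_congr (c : k[X]) {P Q g P' Q' g' : Γ(X.left, ⊤)[X]} {hP : P.Monic}
    {h : IsCoprime P (Q * c.eval₂ (C.comp (constHom X)) g)} (hPP : P = P') (hQ : Q = Q')
    (hg : g = g') :
    (ofPoly c P Q g hP h).zf = (ofPoly c P' Q' g' (hPP ▸ hP) (hPP ▸ hQ ▸ hg ▸ h)).zf := by
  subst hPP hQ hg
  rfl

theorem precomp_ofPoly [IsAffine X'.left] (f : X' ⟶ X) (c : k[X])
    (P Q g : Γ(X.left, ⊤)[X]) (hP : P.Monic)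
    (h : IsCoprime P (Q * c.eval₂ (C.comp (constHom X)) g)) :
    ZF.precomp 1 f _ (ofPoly c P Q g hP h).zf =
      (ofPoly c (P.map f.left.appTop.hom) (Q.map f.left.appTop.hom) (g.map f.left.appTop.hom)
        (hP.map _) (isCoprime_map f h)).zf := by
  rw [precomp_zf]
  refine zf_eq _ _ ?_ (appTop_polyEval _ _) ?_
  · refine (appTop_polyEval _ _).trans ?_
    rw [Polynomial.map_mul]
    rfl
  · refine Closeds.ext ?_
    have h := Scheme.preimage_zeroLocus (affMap 1 f.left) (U := ⊤) {polyEval X.left P}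
    rw [Set.image_singleton] at h
    refine h.trans ?_
    exact congrArg (fun p ↦ Scheme.zeroLocus _ {p}) (appTop_polyEval f.left P)

/-- Coprimality makes the zero loci of `P₁` and `P₂` disjoint, so the additivity relation applies.
The framing `P₁ P₂ Q` is the same on both parts: the factor that does not vanish on a part joins
`Q`. -/
theorem zf_ofPoly_mul (c : k[X]) {P₁ P₂ Q g : Γ(X.left, ⊤)[X]} (hP₁ : P₁.Monic) (hP₂ : P₂.Monic)
    (h : IsCoprime (P₁ * P₂) (Q * c.eval₂ (C.comp (constHom X)) g)) (h₁₂ : IsCoprime P₁ P₂) :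
    (ofPoly c (P₁ * P₂) Q g (hP₁.mul hP₂) h).zf =
      (ofPoly c P₁ (P₂ * Q) g hP₁ (by
        rw [mul_assoc]; exact h₁₂.mul_right h.of_mul_left_left)).zf +
      (ofPoly c P₂ (P₁ * Q) g hP₂ (by
        rw [mul_assoc]; exact h₁₂.symm.mul_right h.of_mul_left_right)).zf := by
  let Z (P : Γ(X.left, ⊤)[X]) : Closeds (Aff 1 X.left) :=
    ⟨(Aff 1 X.left).zeroLocus {polyEval X.left P}, Scheme.zeroLocus_isClosed _ _⟩
  have hd : Disjoint (Z P₁ : Set (Aff 1 X.left)) (Z P₂) := by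
    rw [Set.disjoint_left]
    intro z hz hz'
    have := basicOpen_polyEval_of_isCoprime h₁₂ hz
    change z ∈ Scheme.zeroLocus _ _ at hz'
    rw [Scheme.zeroLocus_singleton] at hz'
    exact hz' this
  have hZ : Z P₁ ⊔ Z P₂ = Z (P₁ * P₂) := by
    refine Closeds.ext ?_
    change Scheme.zeroLocus _ _ ∪ Scheme.zeroLocus _ _ = Scheme.zeroLocus _ _
    rw [Scheme.zeroLocus_singleton, Scheme.zeroLocus_singleton, Scheme.zeroLocus_singleton, map_mul,
      Scheme.basicOpen_mul, Opens.coe_inf, Set.compl_inter]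
  rw [zf_eq_add _ (Z P₁) (Z P₂) hd hZ]
  congr 1
  · refine zf_eq _ _ ?_ rfl rfl
    exact congrArg (polyEval X.left) (by ring)
  · refine zf_eq _ _ ?_ rfl rfl
    exact congrArg (polyEval X.left) (by ring)

/-- The neighbourhoods `D(Q c(g))` and `D(Q c'(g))` differ, but by `zf_eq` the class does not depend
on them. -/
theorem postcomp_ofPoly {c c' : k[X]} (hc : lineOpen k c ≤ lineOpen k c')
    {P Q g : Γ(X.left, ⊤)[X]} {hP : P.Monic}
    (h : IsCoprime P (Q * c.eval₂ (C.comp (constHom X)) g))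
    (h' : IsCoprime P (Q * c'.eval₂ (C.comp (constHom X)) g)) :
    ZF.postcomp 1 X (openIncl hc) (ofPoly c P Q g hP h).zf = (ofPoly c' P Q g hP h').zf := by
  rw [postcomp_zf]
  exact zf_eq _ _ rfl rfl rfl

end LineData

theorem isCoprime_sigma (a : Polynomial k) :
    IsCoprime Polynomial.X ((1 : Polynomial Γ((openInLine k (lineOpen k a)).left, ⊤)) *
      a.eval₂ (Polynomial.C.comp (constHom _)) (.C (openCoord (lineOpen k a)))) := by
  rw [one_mul, ← Polynomial.hom_eval₂]
  have h : IsUnit (Polynomial.C _) := (isUnit_evalFun_openCoord a).map Polynomial.C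
  exact isCoprime_one_right.of_isCoprime_of_dvd_right h.dvd

theorem sigma_eq_ofPoly (a : Polynomial k) :
    sigma (openInLine k (lineOpen k a)) =
      (LineData.ofPoly a .X 1 (.C (openCoord (lineOpen k a))) Polynomial.monic_X
        (isCoprime_sigma a)).zf := by
  rw [sigma_eq]
  refine LineData.zf_eq _ _ ?_ (polyEval_C _ _).symm (Closeds.ext ?_)
  · refine (polyEval_X _).symm.trans (congrArg (polyEval _) (mul_one _).symm)
  · change Scheme.zeroLocus _ (Set.range fun _ : Fin 1 ↦ _) = Scheme.zeroLocus _ _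
    rw [Set.range_const, polyEval_X]

/-! ### The two homotopies -/

section Homotopies

open Polynomial

/-- Modulo `X - s y` the first factor is `1` and the second is the unit `c(y)`. This makes the graph
homotopy of `mk_ofPoly_X_eq` admissible. -/
theorem isCoprime_graph {k R : Type*} [CommRing k] [CommRing R] (κ : k →+* R) (c : k[X]) (s y : R)
    (G : R[X]) (hy : IsUnit (c.eval₂ κ y)) :
    IsCoprime (X - C (s * y)) ((1 + C s * (X - C (s * y)) * G) *
      c.eval₂ (C.comp κ) (C y + C s * (X - C (s * y)))) := by
  refine IsCoprime.mul_right ⟨-(C s * G), 1, by ring⟩ ?_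
  have hu : IsUnit (c.eval₂ (C.comp κ) (C y)) := by
    rw [← hom_eval₂]
    exact hy.map C
  have hd : X - C (s * y) ∣ c.eval₂ (C.comp κ) (C y + C s * (X - C (s * y))) -
      c.eval₂ (C.comp κ) (C y) := by
    rw [← Polynomial.eval_map, ← Polynomial.eval_map]
    exact dvd_trans ⟨C s, by ring⟩ (sub_dvd_eval_sub _ _ _)
  obtain ⟨q, hq⟩ := hd
  obtain ⟨v, hv⟩ := hu.exists_left_inv
  exact ⟨-(v * q), v, by linear_combination v * hq + hv⟩

variable (X : Over (Spec (CommRingCat.of k)))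

/-- The projection `A^1 × X ⟶ X`. -/
def projA1 : A1Prod X ⟶ X := Over.homMk (affProj 1 X.left)

/-- The coordinate of `A^1` as a function on `A^1 × X`. -/
def coordA1 : Γ((A1Prod X).left, ⊤) := coord X.left

theorem zeroSec_coordA1 : (zeroSec X).left.appTop.hom (coordA1 X) = 0 :=
  AffineSpace.homOfVector_appTop_coord _ _ _

theorem oneSec_coordA1 : (oneSec X).left.appTop.hom (coordA1 X) = 1 :=
  AffineSpace.homOfVector_appTop_coord _ _ _

theorem appTop_comp_projA1 {f : X ⟶ A1Prod X} (hf : f ≫ projA1 X = 𝟙 X) :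
    f.left.appTop.hom.comp (projA1 X).left.appTop.hom = RingHom.id _ := by
  have h := congrArg (fun q ↦ q.left.appTop.hom) hf
  rw [Over.comp_left, Scheme.Hom.comp_appTop] at h
  exact h.trans (by simp)

theorem zeroSec_projA1 : zeroSec X ≫ projA1 X = 𝟙 X := by
  ext1
  exact AffineSpace.homOfVector_over _ _

theorem oneSec_projA1 : oneSec X ≫ projA1 X = 𝟙 X := by
  ext1
  exact AffineSpace.homOfVector_over _ _

variable {X}

theorem map_map_projA1 {f : X ⟶ A1Prod X} (hf : f ≫ projA1 X = 𝟙 X) (p : Γ(X.left, ⊤)[X]) :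
    (p.map (projA1 X).left.appTop.hom).map f.left.appTop.hom = p := by
  rw [Polynomial.map_map, appTop_comp_projA1 X hf, Polynomial.map_id]

theorem ZFbar.mk_zeroSec_eq {Y : Over (Spec (CommRingCat.of k))} (h : ZF 1 (A1Prod X) Y) :
    ZFbar.mk (ZF.precomp 1 (zeroSec X) Y h) = ZFbar.mk (ZF.precomp 1 (oneSec X) Y h) := by
  refine (QuotientAddGroup.eq_iff_sub_mem).2 ⟨h, ?_⟩
  rfl

variable [IsAffine X.left]

/-- The linear homotopy between two monic framings with invertible restriction to the complement
of the target. -/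
theorem mk_ofPoly_eq_of_degree_lt (c : k[X]) {H D : Γ(X.left, ⊤)[X]} (hH : H.Monic)
    (hHD : (H + D).Monic) (hD : D.degree < H.degree)
    (hc : c.map (constHom X) ∣ H - 1) (hcD : c.map (constHom X) ∣ D)
    (h₀ : IsCoprime H (1 * c.eval₂ (C.comp (constHom X)) Polynomial.X))
    (h₁ : IsCoprime (H + D) (1 * c.eval₂ (C.comp (constHom X)) Polynomial.X)) :
    ZFbar.mk (LineData.ofPoly c H 1 Polynomial.X hH h₀).zf =
      ZFbar.mk (LineData.ofPoly c (H + D) 1 Polynomial.X hHD h₁).zf := by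
  let ι := (projA1 X).left.appTop.hom
  -- The segment from `H` to `H + D`, parametrized by the coordinate of `A^1`; it stays monic
  -- because `D` has smaller degree.
  let P := H.map ι + C (coordA1 X) * D.map ι
  have hP : P.Monic := by
    rcases subsingleton_or_nontrivial Γ(X.left, ⊤) with hs | hn
    · have : D = 0 := Subsingleton.elim _ _
      simpa [P, this] using hH.map ι
    have := RingHom.domain_nontrivial (zeroSec X).left.appTop.hom
    refine (hH.map ι).add_of_left ?_
    rw [hH.degree_map]
    refine lt_of_le_of_lt ?_ hD
    rw [← smul_eq_C_mul]
    exact (degree_smul_le _ _).trans degree_map_le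
  have hcι : (c.map (constHom X)).map ι = c.map (constHom (A1Prod X)) := by
    rw [Polynomial.map_map]
    exact congrArg (c.map ·) (RingHom.ext (appTop_constHom (projA1 X)))
  have hcP : IsCoprime P (1 * c.eval₂ (C.comp (constHom (A1Prod X))) Polynomial.X) := by
    -- The congruence to `1` mod `c` holds along the whole segment, so the support never meets the
    -- zeros of `c`.
    have h1 : c.map (constHom (A1Prod X)) ∣ P - 1 := by
      rw [← hcι]
      have : P - 1 = (H - 1).map ι + C (coordA1 X) * D.map ι := by
        simp only [P, Polynomial.map_sub, Polynomial.map_one]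
        ring
      rw [this]
      exact dvd_add (Polynomial.map_dvd ι hc) ((Polynomial.map_dvd ι hcD).mul_left _)
    obtain ⟨q, hq⟩ := h1
    change IsCoprime P (1 * c.map (constHom (A1Prod X)))
    exact ⟨1, -q, by linear_combination hq⟩
  have h := ZFbar.mk_zeroSec_eq (LineData.ofPoly c P 1 Polynomial.X hP hcP).zf
  rw [LineData.precomp_ofPoly, LineData.precomp_ofPoly] at h
  have e0 : P.map (zeroSec X).left.appTop.hom = H := by
    simp only [P, Polynomial.map_add, Polynomial.map_mul, map_C, zeroSec_coordA1]
    rw [map_map_projA1 (zeroSec_projA1 X), C_0, zero_mul, add_zero]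
  have e1 : P.map (oneSec X).left.appTop.hom = H + D := by
    simp only [P, Polynomial.map_add, Polynomial.map_mul, map_C, oneSec_coordA1]
    rw [map_map_projA1 (oneSec_projA1 X), map_map_projA1 (oneSec_projA1 X), C_1, one_mul]
  rw [LineData.zf_ofPoly_congr c e0 (Polynomial.map_one _) (Polynomial.map_X _),
    LineData.zf_ofPoly_congr c e1 (Polynomial.map_one _) (Polynomial.map_X _)] at h
  exact h

/-- The homotopy which moves the graph of a function `x` to the zero section and normalizes the
framing. -/
theorem mk_ofPoly_X_eq (c : k[X]) (x : Γ(X.left, ⊤)) (hx : IsUnit (c.eval₂ (constHom X) x))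
    (G : Γ(X.left, ⊤)[X])
    (h₀ : IsCoprime Polynomial.X (1 * c.eval₂ (C.comp (constHom X)) (C x)))
    (h₁ : IsCoprime (Polynomial.X - C x)
      ((1 + (Polynomial.X - C x) * G) * c.eval₂ (C.comp (constHom X)) Polynomial.X)) :
    ZFbar.mk (LineData.ofPoly c Polynomial.X 1 (C x) monic_X h₀).zf =
      ZFbar.mk (LineData.ofPoly c (Polynomial.X - C x) (1 + (Polynomial.X - C x) * G)
        Polynomial.X (monic_X_sub_C x) h₁).zf := by
  let ι := (projA1 X).left.appTop.hom
  let s := coordA1 X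
  -- The graph of `s x` joins the zero section at `s = 0` to the graph of `x` at `s = 1`. On it `Q =
  -- 1` and `g = x`, so the framing is never degenerated by `Q` and the target is never left; at `s
  -- = 1` one has `g = x + (X - x) = X`.
  let P : Γ((A1Prod X).left, ⊤)[X] := Polynomial.X - C (s * ι x)
  let Q := 1 + C s * P * G.map ι
  let g := C (ι x) + C s * P
  have hP : P.Monic := monic_X_sub_C _
  have hcP : IsCoprime P (Q * c.eval₂ (C.comp (constHom (A1Prod X))) g) := by
    have hκ : ι.comp (constHom X) = constHom (A1Prod X) :=
      RingHom.ext (appTop_constHom (projA1 X))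
    have hu := hx.map ι
    rw [hom_eval₂, hκ] at hu
    exact isCoprime_graph (constHom (A1Prod X)) c s (ι x) (G.map ι) hu
  have h := ZFbar.mk_zeroSec_eq (LineData.ofPoly c P Q g hP hcP).zf
  rw [LineData.precomp_ofPoly, LineData.precomp_ofPoly] at h
  have hι {f : X ⟶ A1Prod X} (hf : f ≫ projA1 X = 𝟙 X) (r : Γ(X.left, ⊤)) :
      f.left.appTop.hom (ι r) = r := DFunLike.congr_fun (appTop_comp_projA1 X hf) r
  have e0 : P.map (zeroSec X).left.appTop.hom = Polynomial.X := by
    simp only [P, s, Polynomial.map_sub, map_X, map_C, map_mul, Polynomial.map_mul,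
      zeroSec_coordA1, C_0, zero_mul, sub_zero]
  have e1 : P.map (oneSec X).left.appTop.hom = Polynomial.X - C x := by
    simp only [P, s, Polynomial.map_sub, map_X, map_C, map_mul, Polynomial.map_mul,
      oneSec_coordA1, C_1, one_mul, hι (oneSec_projA1 X)]
  have q0 : Q.map (zeroSec X).left.appTop.hom = 1 := by
    simp only [Q, s, Polynomial.map_add, Polynomial.map_mul, Polynomial.map_one, map_C,
      zeroSec_coordA1, zero_mul, C_0, add_zero]
  have q1 : Q.map (oneSec X).left.appTop.hom = 1 + (Polynomial.X - C x) * G := by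
    simp only [Q, s, Polynomial.map_add, Polynomial.map_mul, Polynomial.map_one, map_C,
      oneSec_coordA1, one_mul, C_1, e1]
    rw [map_map_projA1 (oneSec_projA1 X)]
  have g0 : g.map (zeroSec X).left.appTop.hom = C x := by
    simp only [g, s, Polynomial.map_add, Polynomial.map_mul, map_C,
      zeroSec_coordA1, zero_mul, C_0, add_zero, hι (zeroSec_projA1 X)]
  have g1 : g.map (oneSec X).left.appTop.hom = Polynomial.X := by
    simp only [g, s, Polynomial.map_add, Polynomial.map_mul, map_C,
      oneSec_coordA1, one_mul, C_1, e1, hι (oneSec_projA1 X)]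
    ring
  rw [LineData.zf_ofPoly_congr c e0 q0 g0, LineData.zf_ofPoly_congr c e1 q1 g1] at h
  exact h

end Homotopies

/-! ### Assembling the correspondence -/

open Polynomial in
/-- Injectivity on the affine line for the non-vanishing loci of `a` and `a * b`. -/
theorem exists_postcomp_eq_sigma {a b : k[X]} (ha : a ≠ 0) (hb : b ≠ 0) (hab : IsCoprime a b)
    (hle : lineOpen k (a * b) ≤ lineOpen k a)
    [Nonempty (openInLine k (lineOpen k a)).left] :
    ∃ r : ZF 1 (openInLine k (lineOpen k a)) (openInLine k (lineOpen k (a * b))),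
      ZFbar.postcomp 1 (openInLine k (lineOpen k a)) (openIncl hle) (ZFbar.mk r) =
        ZFbar.mk (sigma (openInLine k (lineOpen k a))) := by
  let X := openInLine k (lineOpen k a)
  -- Makes `Γ(X)` a nontrivial ring, as the degree arguments require.
  have : Nonempty (⊤ : X.left.Opens) := ⟨⟨Classical.arbitrary _, trivial⟩⟩
  let x : Γ(X.left, ⊤) := openCoord (lineOpen k a)
  let κ := constHom X
  have hx : IsUnit (a.eval₂ κ x) := isUnit_evalFun_openCoord a
  obtain ⟨H₁, H₂, hm₁, hm₂, hdeg, h1, h2, h3⟩ := exists_frame_polynomials κ x ha hb hab hx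
  have hmx : ((Polynomial.X - C x) * H₂).Monic := (monic_X_sub_C x).mul hm₂
  have coprime_of_dvd {p q : Γ(X.left, ⊤)[X]} (h : p ∣ q - 1) : IsCoprime q p := by
    obtain ⟨w, hw⟩ := h
    exact ⟨1, -w, by linear_combination hw⟩
  have hmul : (a * b).map κ = a.map κ * b.map κ := Polynomial.map_mul κ
  have c1 : IsCoprime H₁ (1 * (a * b).eval₂ (C.comp κ) Polynomial.X) := by
    rw [one_mul]; exact coprime_of_dvd h1
  have c1a : IsCoprime H₁ (1 * a.eval₂ (C.comp κ) Polynomial.X) := by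
    rw [one_mul]; exact coprime_of_dvd ((Dvd.intro _ hmul.symm).trans h1)
  have c2a : IsCoprime ((Polynomial.X - C x) * H₂) (a.map κ) := coprime_of_dvd h2
  have c2 : IsCoprime H₂ (b.map κ * (Polynomial.X - C x)) := coprime_of_dvd h3
  -- On the zeros of `H₂`, `X - x` and `b` are invertible by `h3`, and `a` by `h2`. The factor `1`
  -- matches the cofactor `P₁ * Q` produced by `zf_ofPoly_mul` with `Q = 1`.
  have c3 : IsCoprime H₂ ((Polynomial.X - C x) * 1 * (a * b).eval₂ (C.comp κ) Polynomial.X) := by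
    change IsCoprime H₂ ((Polynomial.X - C x) * 1 * (a * b).map κ)
    rw [hmul, mul_one]
    exact c2.of_mul_right_right.mul_right
      (c2a.of_mul_left_right.mul_right c2.of_mul_right_left)
  have c3a : IsCoprime H₂ ((Polynomial.X - C x) * 1 * a.eval₂ (C.comp κ) Polynomial.X) := by
    rw [mul_one]
    exact c2.of_mul_right_right.mul_right c2a.of_mul_left_right
  have c4 : IsCoprime ((Polynomial.X - C x) * H₂) (1 * a.eval₂ (C.comp κ) Polynomial.X) := by
    rw [one_mul]; exact c2a
  have hne : H₁ ≠ 0 := hm₁.ne_zero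
  have hD : ((Polynomial.X - C x) * H₂ - H₁).degree < H₁.degree := by
    rw [← neg_sub, degree_neg]
    exact degree_sub_lt_left hdeg hne (hm₁.leadingCoeff.trans hmx.leadingCoeff.symm)
  have hadd : H₁ + ((Polynomial.X - C x) * H₂ - H₁) = (Polynomial.X - C x) * H₂ :=
    add_sub_cancel _ _
  have E1 := mk_ofPoly_eq_of_degree_lt a hm₁ (by rw [hadd]; exact hmx) hD
    ((Dvd.intro _ hmul.symm).trans h1)
    (by
      have := dvd_sub h2 ((Dvd.intro _ hmul.symm).trans h1)
      rwa [sub_sub_sub_cancel_right] at this) c1a (by rw [hadd]; exact c4)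
  -- The end of the segment splits into the graph of `x` and the zeros of `H₂`.
  rw [LineData.zf_ofPoly_congr a hadd rfl rfl,
    LineData.zf_ofPoly_mul a (monic_X_sub_C x) hm₂ c4 c2.of_mul_right_right.symm] at E1
  -- Writes `H₂ = 1 + (X - x) G'`, the form of cofactor that the graph homotopy removes.
  obtain ⟨G', hG'⟩ := (Dvd.intro_left _ rfl : (Polynomial.X - C x) ∣
    b.map κ * (Polynomial.X - C x)).trans h3
  have hG : 1 + (Polynomial.X - C x) * G' = H₂ * 1 := by rw [← hG']; ring
  have c5 : IsCoprime (Polynomial.X - C x)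
      ((1 + (Polynomial.X - C x) * G') * a.eval₂ (C.comp κ) Polynomial.X) := by
    rw [hG, mul_one]
    exact c2.of_mul_right_right.symm.mul_right c2a.of_mul_left_left
  have E2 := mk_ofPoly_X_eq a x hx G' (isCoprime_sigma a) c5
  rw [LineData.zf_ofPoly_congr a rfl hG rfl] at E2
  -- The subtracted term is the unwanted summand of `E1`, already defined with values in `D(ab)`.
  refine ⟨(LineData.ofPoly (a * b) H₁ 1 Polynomial.X hm₁ c1).zf -
    (LineData.ofPoly (a * b) H₂ ((Polynomial.X - C x) * 1) Polynomial.X hm₂ c3).zf, ?_⟩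
  change ZFbar.mk (ZF.postcomp 1 X (openIncl hle) _) = _
  rw [map_sub, LineData.postcomp_ofPoly hle c1 c1a, LineData.postcomp_ofPoly hle c3 c3a,
    sigma_eq_ofPoly, E2]
  refine (congrArg (· - ZFbar.mk _) E1).trans ?_
  exact add_sub_cancel_right (ZFbar.mk _) (ZFbar.mk _)

end FramedTransfers

theorem mainTheorem6 {k : Type*} [Field k]
    (U V : (FramedTransfers.Aff 1 (Spec (CommRingCat.of k))).Opens) (hVU : V ≤ U)
    (hV : (V : Set (FramedTransfers.Aff 1 (Spec (CommRingCat.of k)))).Nonempty) :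
    ∃ r : FramedTransfers.ZF 1 (FramedTransfers.openInLine k U) (FramedTransfers.openInLine k V),
      FramedTransfers.ZFbar.postcomp 1 (FramedTransfers.openInLine k U)
          (FramedTransfers.openIncl hVU) (FramedTransfers.ZFbar.mk r) =
        FramedTransfers.ZFbar.mk (FramedTransfers.sigma (FramedTransfers.openInLine k U)) := by
  obtain ⟨a, b, ha, hb, hab, rfl, rfl⟩ := FramedTransfers.exists_eq_lineOpen hVU hV
  obtain ⟨x, hx⟩ := hV
  have : Nonempty (FramedTransfers.openInLine k (FramedTransfers.lineOpen k a)).left :=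
    ⟨⟨x, hVU hx⟩⟩
  exact FramedTransfers.exists_postcomp_eq_sigma ha hb hab hVU
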